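/- Let $N$ be a finite weighted bipartite network (parallel edges allowed, every edge joins a black vertex to a white vertex) embedded in a closed disk, with $n$ boundary vertices $1,\dots,n$ lying on the boundary circle in clockwise order. All other vertices are interior vertices. Each boundary vertex has degree $1$ and no edge joins two boundary vertices. An \emph{almost perfect matching} $\Pi$ of $N$ is a set of edges that uses each interior vertex exactly once (boundary vertices may or may not be used). Its boundary subset $I(\Pi)\subset[n]$ consists of the black boundary vertices used by $\Pi$ together with the white boundary vertices not used by $\Pi$. Let $$k = d'+d,$$ where $d'$ is the number of boundary vertices adjacent to an interior black vertex and $d$ is the number of interior white vertices minus the number of interior black vertices. For $I\subset[n]$ put $$\Delta_I(N)=\sum_{\Pi:\ I(\Pi)=I}\ \prod_{e\in\Pi}\mathrm{wt}(e),$$ the sum being over almost perfect matchings $\Pi$. For sequences of $k$ indices write $\Delta_{i_1,\dots,i_k}$ for the antisymmetric extension of $I\mapsto\Delta_I(N)$. \textbf{Theorem.} Suppose that $N$ has nonnegative real weights and that almost perfect matchings of $N$ exist. Then $k\ge 0$, every almost perfect matching $\Pi$ satisfies $|I(\Pi)|=k$, and the numbers $\Delta_I(N)$, $I\in\binom{[n]}{k}$,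 satisfy the Plücker relations: if $k\ge1$, then for all $i_1,\dots,i_{k-1},\,j_1,\dots,j_{k+1}\in[n]$, $$\sum_{s=1}^{k+1}(-1)^s\,\Delta_{i_1,\dots,i_{k-1},j_s}\,\Delta_{j_1,\dots,j_{s-1},\widehat{j_s},j_{s+1},\dots,j_{k+1}}=0 .$$ If moreover some almost perfect matching of $N$ has nonzero weight, then the $\Delta_I(N)$ are the homogeneous Plücker coordinates of a unique point of the Grassmannian: there is exactly one $k$-dimensional subspace $X(N)\subset\mathbb{C}^n$ such that, up to one common nonzero scalar, the numbers $\Delta_I(N)$, $I\in\binom{[n]}{k}$, are the $k\times k$ minors (columns in increasing order) of a $k\times n$ matrix with row span $X(N)$. -/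

import Mathlib

noncomputable section

/-- The two colours of the vertices of a bipartite network. -/
inductive VertexColor
  | black
  | white
  deriving DecidableEq

/-- A weighted bipartite network with interior vertices `V`, boundary vertices labelled by `Fin n`,
and edges `E` (parallel edges are allowed). Every edge joins a black vertex to a white vertex,
every boundary vertex has degree one, and no edge joins two boundary vertices. -/
structure BipartiteNetwork (n : ℕ) (V E : Type*) where
  color : V ⊕ Fin n → VertexColor
  blackEnd : E → V ⊕ Fin n
  whiteEnd : E → V ⊕ Fin n
  color_blackEnd : ∀ e, color (blackEnd e) = VertexColor.black
  color_whiteEnd : ∀ e, color (whiteEnd e) = VertexColor.white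
  boundary_degree : ∀ i : Fin n, ∃! e : E, blackEnd e = Sum.inr i ∨ whiteEnd e = Sum.inr i
  not_boundary_boundary : ∀ (e : E) (i j : Fin n),
    ¬ (blackEnd e = Sum.inr i ∧ whiteEnd e = Sum.inr j)
  weight : E → ℝ

namespace BipartiteNetwork

variable {n : ℕ} {V E : Type*}

/-- The edge `e` is incident to the vertex `x`. -/
def Incident (N : BipartiteNetwork n V E) (e : E) (x : V ⊕ Fin n) : Prop :=
  N.blackEnd e = x ∨ N.whiteEnd e = x

/-- An embedding of the network in the closed unit disk of the complex plane: distinct vertices are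
distinct points, interior vertices lie in the open disk, the boundary vertices lie on the unit
circle in clockwise order, and edges are simple arcs which, apart from their end points, stay in
the open disk and meet neither a vertex nor another edge. -/
structure DiskEmbedding (N : BipartiteNetwork n V E) where
  pos : V ⊕ Fin n → ℂ
  pos_injective : Function.Injective pos
  norm_pos_interior : ∀ v : V, ‖pos (Sum.inl v)‖ < 1
  angle : Fin n → ℝ
  angle_strictMono : StrictMono angle
  angle_lt : ∀ i j : Fin n, angle j < angle i + 2 * Real.pi
  pos_boundary : ∀ i : Fin n, pos (Sum.inr i) = Complex.exp (-(angle i : ℂ) * Complex.I)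
  arc : ∀ e : E, Path (pos (N.blackEnd e)) (pos (N.whiteEnd e))
  arc_injective : ∀ e : E, Function.Injective (arc e)
  norm_arc_lt : ∀ (e : E) (t : unitInterval), t ≠ 0 → t ≠ 1 → ‖arc e t‖ < 1
  arc_eq_pos : ∀ (e : E) (t : unitInterval) (x : V ⊕ Fin n), arc e t = pos x → t = 0 ∨ t = 1
  arc_eq_arc : ∀ (e e' : E) (s t : unitInterval), e ≠ e' → arc e s = arc e' t →
    (s = 0 ∨ s = 1) ∧ (t = 0 ∨ t = 1)

/-- A set of edges is an almost perfect matching if each interior vertex is used exactly once and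
each boundary vertex may or may not be used. -/
def IsAlmostPerfectMatching (N : BipartiteNetwork n V E) (P : Finset E) : Prop :=
  ∀ v : V, ∃! e : E, e ∈ P ∧ N.Incident e (Sum.inl v)

open scoped Classical in
/-- The boundary subset of a set of edges: the black boundary vertices that are used together with
the white boundary vertices that are not used. -/
def boundarySubset (N : BipartiteNetwork n V E) (P : Finset E) : Finset (Fin n) :=
  Finset.univ.filter fun i =>
    (N.color (Sum.inr i) = VertexColor.black ∧ ∃ e ∈ P, N.Incident e (Sum.inr i)) ∨
    (N.color (Sum.inr i) = VertexColor.white ∧ ¬ ∃ e ∈ P, N.Incident e (Sum.inr i))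

open scoped Classical in
/-- The number of boundary vertices that are adjacent to an interior black vertex, plus the number
of interior white vertices, minus the number of interior black vertices. -/
def rank [Fintype V] (N : BipartiteNetwork n V E) : ℤ :=
  ((Finset.univ.filter fun i : Fin n => ∃ (e : E) (v : V), N.Incident e (Sum.inr i) ∧
      N.Incident e (Sum.inl v) ∧ N.color (Sum.inl v) = VertexColor.black).card : ℤ) +
  (((Finset.univ.filter fun v : V => N.color (Sum.inl v) = VertexColor.white).card : ℤ) -
    ((Finset.univ.filter fun v : V => N.color (Sum.inl v) = VertexColor.black).card : ℤ))

open scoped Classical in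
/-- The dimer partition function with boundary subset `I`. -/
def dimerPartition [Fintype E] (N : BipartiteNetwork n V E) (I : Finset (Fin n)) : ℝ :=
  ∑ P ∈ (Finset.univ : Finset (Finset E)).filter
    (fun P => N.IsAlmostPerfectMatching P ∧ N.boundarySubset P = I), ∏ e ∈ P, N.weight e

end BipartiteNetwork

open scoped Classical in
/-- The antisymmetric extension to sequences of a function `p` on subsets:
`p_{f 0, …, f (k - 1)}` is zero if an index is repeated, and otherwise it is the value of `p` at
the set of indices times the sign of the permutation that sorts the sequence. -/
def antisymmetricCoord {n k : ℕ} (p : Finset (Fin n) → ℝ) (f : Fin k → Fin n) : ℝ :=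
  if Function.Injective f then
    ((Equiv.Perm.sign (Tuple.sort f) : ℤ) : ℝ) * p (Finset.univ.image f)
  else 0

/-- The (one index exchange) Plücker relations for the numbers `p I`, `I` a `k`-element subset:
for all `i_1, …, i_{k-1}` and `j_1, …, j_{k+1}`,
`∑_s (-1)^s p_{i_1, …, i_{k-1}, j_s} p_{j_1, …, j_{s-1}, j_{s+1}, …, j_{k+1}} = 0`.
Here `k = m + 1`; there is no relation for `k = 0`. -/
def PluckerRelations {n : ℕ} (k : ℕ) (p : Finset (Fin n) → ℝ) : Prop :=
  ∀ m : ℕ, k = m + 1 → ∀ (i : Fin m → Fin n) (j : Fin (m + 2) → Fin n),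
    ∑ s : Fin (m + 2), (-1 : ℝ) ^ (s : ℕ) *
      antisymmetricCoord p (Fin.snoc (α := fun _ => Fin n) i (j s)) *
      antisymmetricCoord p (fun t : Fin (m + 1) => j (s.succAbove t)) = 0

/-- The complex Grassmannian of `k`-dimensional subspaces of `ℂⁿ`. -/
def ComplexGrassmannian (k n : ℕ) : Type :=
  {X : Submodule ℂ (Fin n → ℂ) // Module.finrank ℂ X = k}

/-- The numbers `p I`, for the `k`-element subsets `I`, are homogeneous Plücker coordinates of `X`:
up to a common nonzero scalar they are the maximal minors (columns in increasing order) of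
a `k × n` matrix with row span `X`. -/
def IsPluckerCoordinates {k n : ℕ} (X : ComplexGrassmannian k n) (p : Finset (Fin n) → ℝ) : Prop :=
  ∃ M : Matrix (Fin k) (Fin n) ℂ, Submodule.span ℂ (Set.range fun a => M a) = X.1 ∧
    ∃ c : ℂ, c ≠ 0 ∧ ∀ (I : Finset (Fin n)) (hI : I.card = k),
      (p I : ℂ) = c * (M.submatrix id (I.orderEmbOfFin hI)).det

end

/-! A product of two coordinates expands into a sum over pairs of matchings, so a Plücker relation
is a signed sum over triples (s, P, Q) in which P has boundary subset {i_1, …, i_{k-1}, j_s} and Q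
has the set of the j's other than j_s. The symmetric difference of P and Q consists of cycles and of
paths that pair up boundary vertices. Swapping P and Q along the path that starts at j_s gives a
triple of the same weight for the other end j_t of that path, and doing this twice gives back the
original triple.

The swap reverses the sign because of planarity. No other path crosses the chosen one, so the path
ends strictly between j_s and j_t are paired among themselves; each path has exactly one end in each
boundary subset, hence both subsets have equally many elements in that interval
(`DiskEmbedding.card_between_eq`). This count is what `orderSign_exchange` needs, and
`pluckerRelations_dimerPartition` is the resulting cancellation. The topological input,
`exists_eq_of_interlace`, is a winding argument for the difference of two curves.

All boundary subsets have the same size because every edge has one black and one white end, so a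
matching can be counted by either colour (`IsAlmostPerfectMatching.card_boundarySubset`).

For the Grassmannian, normalise at a nonzero coordinate with index sequence g. The coordinates that
differ from g in at most one place fill a matrix that is the identity in the columns g. The Plücker
relations express all remaining coordinates recursively, just as determinants expand along a column
(`det_reducedMatrix_submatrix`). By Cramer's rule any matrix with these minors has the same row
span. Nonnegative weights exclude cancellation in a partition function, so a single matching of
nonzero weight gives a nonzero coordinate. -/

/-! ### Curves in the closed disk with interlacing end points -/

section DiskTopology

open Complex Real

/-- The real part of `1 - w` is positive unless `w = 1`. This makes the principal logarithm
continuous along a curve seen from a point of the unit circle. -/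
theorem one_sub_mem_slitPlane {w : ℂ} (hw : ‖w‖ ≤ 1) (h1 : w ≠ 1) : 1 - w ∈ slitPlane := by
  rw [mem_slitPlane_iff]
  left
  have h2 : w.re ≤ 1 := (re_le_norm w).trans hw
  rcases h2.lt_or_eq with h | h
  · simpa using h
  · exfalso
    apply h1
    have h3 : w.re * w.re + w.im * w.im ≤ 1 := by
      rw [← normSq_apply, normSq_eq_norm_sq]
      exact pow_le_one₀ (norm_nonneg _) hw
    rw [h] at h3
    have h4 : w.im = 0 := by nlinarith [sq_nonneg w.im]
    exact Complex.ext (by simpa using h) (by simpa using h4)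

/-- The increment of a continuous logarithm of `t ↦ u * (1 - δ t / c)`, where `c` lies on the unit
circle and `δ` in the closed unit disk, can be computed with the principal branch. -/
theorem log_increment {c u : ℂ} (hc : ‖c‖ = 1) {δ L : ℝ → ℂ} (hδ : Continuous δ)
    (hL : Continuous L) (hn : ∀ t, ‖δ t‖ ≤ 1) (hne : ∀ t, δ t ≠ c)
    (h : ∀ t, exp (L t) = u * (1 - δ t / c)) (s t : ℝ) :
    (L t).im - (L s).im = arg (1 - δ t / c) - arg (1 - δ s / c) := by
  have hc0 : c ≠ 0 := by
    rintro rfl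
    simp at hc
  have hsl : ∀ t, 1 - δ t / c ∈ slitPlane := fun t =>
    one_sub_mem_slitPlane (by rw [norm_div, hc, div_one]; exact hn t)
      (fun h => hne t (by rwa [div_eq_one_iff_eq hc0] at h))
  have hlog : Continuous fun t => L t - log (1 - δ t / c) := by
    refine hL.sub (Continuous.clog (by fun_prop) hsl)
  have hexp : ∀ t, exp (L t - log (1 - δ t / c)) = u := fun t => by
    rw [Complex.exp_sub, h, exp_log (slitPlane_ne_zero (hsl t)),
      mul_div_cancel_right₀ _ (slitPlane_ne_zero (hsl t))]
  -- The two logarithms differ by a continuous function with constant exponential, which is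
  -- therefore constant.
  have key := isCoveringMap_exp.const_of_comp hlog
    (fun a a' => Subtype.ext (by simp only [hexp])) t s
  have := congrArg Complex.im key
  simp only [sub_im, log_im] at this
  linarith

/-- Half-angle formulas give the polar form of a chord: its length is `2 * sin (φ / 2)`. -/
theorem arg_one_sub_exp_neg {φ : ℝ} (h0 : 0 < φ) (h1 : φ < 2 * π) :
    arg (1 - exp (-(φ : ℂ) * I)) = π / 2 - φ / 2 := by
  have hs : 0 < Real.sin (φ / 2) := Real.sin_pos_of_pos_of_lt_pi (by linarith) (by linarith)
  have : 1 - exp (-(φ : ℂ) * I) = ((2 * Real.sin (φ / 2) : ℝ) : ℂ) *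
      (Complex.cos ((π / 2 - φ / 2 : ℝ) : ℂ) + Complex.sin ((π / 2 - φ / 2 : ℝ) : ℂ) * I) := by
    have e : -(φ : ℂ) * I = ((-φ : ℝ) : ℂ) * I := by push_cast; ring
    rw [e, exp_mul_I, ← ofReal_cos, ← ofReal_sin, ← ofReal_cos, ← ofReal_sin,
      Real.cos_pi_div_two_sub, Real.sin_pi_div_two_sub, Real.cos_neg, Real.sin_neg]
    have hφ : φ = 2 * (φ / 2) := by ring
    have e1 : Real.cos φ = 1 - 2 * Real.sin (φ / 2) ^ 2 := by
      conv_lhs => rw [hφ]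
      rw [Real.cos_two_mul, Real.cos_sq']
      ring
    have e2 : Real.sin φ = 2 * Real.sin (φ / 2) * Real.cos (φ / 2) := by
      conv_lhs => rw [hφ]
      rw [Real.sin_two_mul]
    rw [e1, e2]
    push_cast
    ring
  rw [this]
  exact arg_mul_cos_add_sin_mul_I (by positivity) ⟨by linarith, by linarith⟩

theorem arg_one_sub_exp_neg_of_neg {φ : ℝ} (h0 : φ < 0) (h1 : -(2 * π) < φ) :
    arg (1 - exp (-(φ : ℂ) * I)) = -(π / 2) - φ / 2 := by
  have h := arg_one_sub_exp_neg (φ := φ + 2 * π) (by linarith) (by linarith)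
  have e : -((φ + 2 * π : ℝ) : ℂ) * I = -(φ : ℂ) * I - 2 * π * I := by push_cast; ring
  rw [e, exp_periodic.sub_eq] at h
  rw [h]
  ring

/-- A continuous nowhere vanishing function on the plane has a continuous logarithm. -/
theorem exists_continuous_log {F : ℝ × ℝ → ℂ} (hF : Continuous F) (h0 : ∀ x, F x ≠ 0) :
    ∃ L : ℝ × ℝ → ℂ, Continuous L ∧ ∀ x, exp (L x) = F x := by
  obtain ⟨L, ⟨-, hL⟩, -⟩ := isCoveringMapOn_exp.existsUnique_continuousMap_lifts
    (⟨F, hF⟩ : C(ℝ × ℝ, ℂ)) (a₀ := 0) (e₀ := log (F 0)) (exp_log (h0 0)) (fun a => h0 a)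
  exact ⟨L, L.continuous, fun x => congrFun hL x⟩

/-- Two curves in the closed unit disk whose end points interlace on the unit circle meet. -/
theorem exists_eq_of_interlace {a b c d : ℝ} (hab : a < b) (hbc : b < c) (hcd : c < d)
    (hda : d < a + 2 * π) {γ δ : ℝ → ℂ} (hγ : Continuous γ) (hδ : Continuous δ)
    (hγn : ∀ t, ‖γ t‖ ≤ 1) (hδn : ∀ t, ‖δ t‖ ≤ 1)
    (hγ0 : γ 0 = exp (-(a : ℂ) * I)) (hγ1 : γ 1 = exp (-(c : ℂ) * I))
    (hδ0 : δ 0 = exp (-(b : ℂ) * I)) (hδ1 : δ 1 = exp (-(d : ℂ) * I)) :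
    ∃ s t, γ s = δ t := by
  by_contra! hne
  -- If the curves were disjoint, their difference would have a logarithm on the whole square. On
  -- each side of the square one curve rests at a point of the unit circle, so the increment of the
  -- argument there is explicit.
  obtain ⟨L, hL, hexp⟩ := exists_continuous_log (F := fun x => γ x.1 - δ x.2) (by fun_prop)
    (fun x => sub_ne_zero.2 (hne _ _))
  have hnorm : ∀ x : ℝ, ‖exp (-(x : ℂ) * I)‖ = 1 := fun x => by
    have : -(x : ℂ) * I = ((-x : ℝ) : ℂ) * I := by push_cast; ring
    rw [this, norm_exp_ofReal_mul_I]
  have hdiv : ∀ x y : ℝ, exp (-(x : ℂ) * I) / exp (-(y : ℂ) * I)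
      = exp (-((x - y : ℝ) : ℂ) * I) := fun x y => by
    rw [← Complex.exp_sub]
    congr 1
    push_cast
    ring
  have e1 := log_increment (hnorm a) (u := exp (-(a : ℂ) * I)) (L := fun t => L (0, t)) hδ
    (by fun_prop) hδn (fun t => by rw [← hγ0]; exact (hne 0 t).symm)
    (fun t => by rw [hexp, mul_sub, mul_div_cancel₀ _ (Complex.exp_ne_zero _), mul_one, hγ0]) 0 1
  have e2 := log_increment (hnorm c) (u := exp (-(c : ℂ) * I)) (L := fun t => L (1, t)) hδ
    (by fun_prop) hδn (fun t => by rw [← hγ1]; exact (hne 1 t).symm)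
    (fun t => by rw [hexp, mul_sub, mul_div_cancel₀ _ (Complex.exp_ne_zero _), mul_one, hγ1]) 0 1
  have e3 := log_increment (hnorm b) (u := -exp (-(b : ℂ) * I)) (L := fun t => L (t, 0)) hγ
    (by fun_prop) hγn (fun t => by rw [← hδ0]; exact (hne t 0))
    (fun t => by
      rw [hexp, neg_mul, mul_sub, mul_div_cancel₀ _ (Complex.exp_ne_zero _), mul_one, hδ0, neg_sub]) 0 1
  have e4 := log_increment (hnorm d) (u := -exp (-(d : ℂ) * I)) (L := fun t => L (t, 1)) hγ
    (by fun_prop) hγn (fun t => by rw [← hδ1]; exact (hne t 1))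
    (fun t => by
      rw [hexp, neg_mul, mul_sub, mul_div_cancel₀ _ (Complex.exp_ne_zero _), mul_one, hδ1, neg_sub]) 0 1
  simp only [hγ0, hγ1, hδ0, hδ1, hdiv] at e1 e2 e3 e4
  rw [arg_one_sub_exp_neg (φ := d - a) (by linarith) (by linarith),
    arg_one_sub_exp_neg (φ := b - a) (by linarith) (by linarith)] at e1
  rw [arg_one_sub_exp_neg (φ := d - c) (by linarith) (by linarith),
    arg_one_sub_exp_neg_of_neg (φ := b - c) (by linarith) (by linarith)] at e2
  rw [arg_one_sub_exp_neg (φ := c - b) (by linarith) (by linarith),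
    arg_one_sub_exp_neg_of_neg (φ := a - b) (by linarith) (by linarith)] at e3
  rw [arg_one_sub_exp_neg_of_neg (φ := c - d) (by linarith) (by linarith),
    arg_one_sub_exp_neg_of_neg (φ := a - d) (by linarith) (by linarith)] at e4
  -- The two ways from corner (0, 0) to corner (1, 1) give increments that differ by `2 * π`.
  linarith [Real.pi_pos]

/-- Two sets in the closed unit disk that join interlacing pairs of points of the unit circle
meet. -/
theorem not_disjoint_of_interlace {a b c d : ℝ} (hab : a < b) (hbc : b < c) (hcd : c < d)
    (hda : d < a + 2 * π) {S T : Set ℂ} (hSn : ∀ z ∈ S, ‖z‖ ≤ 1) (hTn : ∀ z ∈ T, ‖z‖ ≤ 1)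
    (hS : JoinedIn S (exp (-(a : ℂ) * I)) (exp (-(c : ℂ) * I)))
    (hT : JoinedIn T (exp (-(b : ℂ) * I)) (exp (-(d : ℂ) * I))) : ¬ Disjoint S T := by
  obtain ⟨γ, hγ⟩ := hS
  obtain ⟨δ, hδ⟩ := hT
  have hγ' : ∀ t, γ.extend t ∈ S := fun t => hγ _
  have hδ' : ∀ t, δ.extend t ∈ T := fun t => hδ _
  obtain ⟨s, t, hst⟩ := exists_eq_of_interlace hab hbc hcd hda γ.continuous_extend
    δ.continuous_extend (fun t => hSn _ (hγ' t)) (fun t => hTn _ (hδ' t))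
    γ.extend_zero γ.extend_one δ.extend_zero δ.extend_one
  intro h
  exact Set.disjoint_left.1 h (hγ' s) (hst ▸ hδ' t)

end DiskTopology

/-! ### Signs of orderings -/

section OrderSign

open Finset

/-- The sign of the permutation that sorts a finite sequence of integers, and zero if an entry is
repeated. -/
def orderSign {k : ℕ} (f : Fin k → ℤ) : ℤ :=
  ∏ x, ∏ y ∈ Ioi x, (f y - f x).sign

theorem orderSign_comp_perm {k : ℕ} (f : Fin k → ℤ) (σ : Equiv.Perm (Fin k)) :
    orderSign (f ∘ σ) = (Equiv.Perm.sign σ : ℤ) * orderSign f := by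
  have := σ.prod_Ioi_comp_eq_sign_mul_prod (R := ℤ) (f := fun x y => (f y - f x).sign)
    (fun x y => by rw [← Int.sign_neg, neg_sub])
  simpa [orderSign] using this

theorem orderSign_strictMono {k : ℕ} {f : Fin k → ℤ} (hf : StrictMono f) : orderSign f = 1 :=
  prod_eq_one fun x _ => prod_eq_one fun y hy => by
    rw [Int.sign_eq_one_iff_pos, sub_pos]
    exact hf (mem_Ioi.1 hy)

theorem orderSign_eq_zero {k : ℕ} {f : Fin k → ℤ} (hf : ¬ Function.Injective f) :
    orderSign f = 0 := by
  simp only [Function.Injective, not_forall] at hf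
  obtain ⟨x, y, hxy, hne⟩ := hf
  rcases lt_or_gt_of_ne hne with h | h
  · exact prod_eq_zero (mem_univ x) (prod_eq_zero (mem_Ioi.2 h) (by simp [hxy]))
  · exact prod_eq_zero (mem_univ y) (prod_eq_zero (mem_Ioi.2 h) (by simp [hxy]))

theorem orderSign_cons {k : ℕ} (a : ℤ) (f : Fin k → ℤ) :
    orderSign (Fin.cons a f : Fin (k + 1) → ℤ) = (∏ x, (f x - a).sign) * orderSign f := by
  rw [orderSign, Fin.prod_univ_succ]
  congr 1
  · rw [Fin.Ioi_zero_eq_map, prod_map]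
    simp
  · refine prod_congr rfl fun x _ => ?_
    rw [Fin.Ioi_succ, prod_map]
    simp

theorem orderSign_snoc {k : ℕ} (f : Fin k → ℤ) (a : ℤ) :
    orderSign (Fin.snoc f a : Fin (k + 1) → ℤ) =
      (-1) ^ k * ((∏ x, (f x - a).sign) * orderSign f) := by
  rw [Fin.snoc_eq_cons_rotate, ← orderSign_cons]
  have := orderSign_comp_perm (Fin.cons a f : Fin (k + 1) → ℤ) (finRotate (k + 1))
  rw [sign_finRotate] at this
  simpa [Function.comp_def] using this

/-- Moving slot `s` to the front is a cycle of sign `(-1) ^ s`; this reduces a change in any slot to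
a change in the first one. -/
theorem update_comp_cycleRange_symm {α : Type*} {k : ℕ} (f : Fin (k + 1) → α) (s : Fin (k + 1))
    (a : α) : Function.update f s a ∘ s.cycleRange.symm =
      (Fin.cons a (fun x => f (s.succAbove x)) : Fin (k + 1) → α) := by
  funext x
  refine Fin.cases ?_ (fun y => ?_) x
  · simp
  · simp [Fin.cycleRange_symm_succ]

theorem orderSign_update {k : ℕ} (f : Fin (k + 1) → ℤ) (s : Fin (k + 1)) (a : ℤ) :
    orderSign (Function.update f s a) =
      (-1) ^ (s : ℕ) * ((∏ x, (f (s.succAbove x) - a).sign) *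
        orderSign (fun x => f (s.succAbove x))) := by
  rw [← orderSign_cons, ← update_comp_cycleRange_symm, orderSign_comp_perm]
  rw [Equiv.Perm.sign_symm, Fin.sign_cycleRange]
  push_cast
  rw [← mul_assoc, ← mul_pow]
  simp

/-- This is `orderSign_update` with `f s` put back in its own slot; for distinct entries the product
of signs squares to 1 and can change sides. -/
theorem neg_one_pow_mul_orderSign_succAbove {k : ℕ} {f : Fin (k + 1) → ℤ}
    (hf : Function.Injective f) (s : Fin (k + 1)) :
    (-1) ^ (s : ℕ) * orderSign (fun x => f (s.succAbove x)) =
      (∏ x, (f (s.succAbove x) - f s).sign) * orderSign f := by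
  have h := orderSign_update f s (f s)
  rw [Function.update_eq_self] at h
  have h2 : (∏ x, (f (s.succAbove x) - f s).sign) * (∏ x, (f (s.succAbove x) - f s).sign) = 1 := by
    rw [← prod_mul_distrib]
    refine prod_eq_one fun x _ => ?_
    have : f (s.succAbove x) - f s ≠ 0 := sub_ne_zero.2 fun h => s.succAbove_ne x (hf h)
    rcases lt_or_gt_of_ne this with h | h
    · simp [Int.sign_eq_neg_one_of_neg h]
    · simp [Int.sign_eq_one_of_pos h]
  rw [h]
  linear_combination (-1 : ℤ) * (-1) ^ (s : ℕ) * orderSign (fun x => f (s.succAbove x)) * h2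

theorem neg_one_pow_mul_orderSign_succAbove_of_eq {k : ℕ} {f : Fin (k + 1) → ℤ}
    {s t : Fin (k + 1)} (hst : s ≠ t) (hf : f s = f t) :
    (-1) ^ (s : ℕ) * orderSign (fun x => f (s.succAbove x)) =
      -((-1) ^ (t : ℕ) * orderSign (fun x => f (t.succAbove x))) := by
  -- A value above all entries contributes the same factor `(-1) ^ k` from every slot. Filling slot
  -- `s` or slot `t` with it gives sequences that differ by a transposition, since `f s = f t`.
  obtain ⟨C, hC⟩ : ∃ C : ℤ, ∀ x, f x < C := by
    refine ⟨univ.sup' univ_nonempty f + 1, fun x => Int.lt_add_one_iff.2 ?_⟩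
    exact le_sup' f (mem_univ x)
  have key : ∀ s : Fin (k + 1), orderSign (Function.update f s C) =
      (-1) ^ k * ((-1) ^ (s : ℕ) * orderSign (fun x => f (s.succAbove x))) := fun s => by
    rw [orderSign_update]
    have : ∏ x, (f (s.succAbove x) - C).sign = (-1) ^ k := by
      rw [prod_congr rfl fun x _ => Int.sign_eq_neg_one_of_neg (sub_neg.2 (hC _))]
      simp
    rw [this]
    ring
  have hswap : Function.update f s C ∘ Equiv.swap s t = Function.update f t C := by
    funext x
    by_cases hxs : x = s
    · subst hxs
      simp [Function.update_of_ne hst, Function.update_of_ne hst.symm, hf]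
    by_cases hxt : x = t
    · subst hxt
      simp
    · simp [Equiv.swap_apply_of_ne_of_ne hxs hxt, Function.update_of_ne, hxs, hxt]
  have h := orderSign_comp_perm (Function.update f s C) (Equiv.swap s t)
  rw [hswap, Equiv.Perm.sign_swap hst, key, key] at h
  push_cast at h
  refine mul_left_cancel₀ (pow_ne_zero k (by norm_num : (-1 : ℤ) ≠ 0)) ?_
  linear_combination h

theorem prod_succAbove_eq_prod_erase {M : Type*} [CommMonoid M] {k : ℕ} (g : Fin (k + 1) → M)
    (s : Fin (k + 1)) : ∏ x, g (s.succAbove x) = ∏ y ∈ univ.erase s, g y := by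
  have : (univ.erase s : Finset (Fin (k + 1))) = univ.map s.succAboveEmb := by
    rw [Fin.univ_succAbove k s, erase_cons]
  rw [this, prod_map]
  simp

/-- The sign attached to the position of `z` relative to the open interval with end points `a`
and `b`. -/
def betweenSign {α : Type*} [LinearOrder α] (a b z : α) : ℤ :=
  if min a b < z ∧ z < max a b then -1 else 1

theorem betweenSign_left {α : Type*} [LinearOrder α] (a b : α) : betweenSign a b a = 1 :=
  if_neg fun h => by
    rcases le_total a b with h' | h' <;> simp [h'] at h

theorem betweenSign_right {α : Type*} [LinearOrder α] (a b : α) : betweenSign a b b = 1 :=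
  if_neg fun h => by
    rcases le_total a b with h' | h' <;> simp [h'] at h

theorem prod_betweenSign {α : Type*} [LinearOrder α] (a b : α) (S : Finset α) :
    ∏ z ∈ S, betweenSign a b z = (-1) ^ #{z ∈ S | min a b < z ∧ z < max a b} := by
  simp only [betweenSign]
  rw [prod_ite, prod_const, prod_const_one, mul_one]

theorem sign_sub_mul_sign_sub {n : ℕ} {a b z : Fin n} (ha : z ≠ a) (hb : z ≠ b) :
    ((z : ℤ) - a).sign * ((z : ℤ) - b).sign = betweenSign a b z := by
  have ha' := Fin.val_ne_of_ne ha
  have hb' := Fin.val_ne_of_ne hb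
  have h : (min a b < z ∧ z < max a b) ↔
      ((a : ℕ) < z ∧ (z : ℕ) < b ∨ (b : ℕ) < z ∧ (z : ℕ) < a) := by
    simp only [min_lt_iff, lt_max_iff, Fin.lt_def]
    omega
  simp only [betweenSign, h]
  rcases lt_or_gt_of_ne ha' with h1 | h1 <;> rcases lt_or_gt_of_ne hb' with h2 | h2
  · rw [Int.sign_eq_neg_one_of_neg (by omega), Int.sign_eq_neg_one_of_neg (by omega),
      if_neg (by omega)]
    rfl
  · rw [Int.sign_eq_neg_one_of_neg (by omega), Int.sign_eq_one_of_pos (by omega),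
      if_pos (by omega)]
    rfl
  · rw [Int.sign_eq_one_of_pos (by omega), Int.sign_eq_neg_one_of_neg (by omega),
      if_pos (by omega)]
    rfl
  · rw [Int.sign_eq_one_of_pos (by omega), Int.sign_eq_one_of_pos (by omega),
      if_neg (by omega)]
    rfl

/-- Exchanging `j s` and `j t` reverses the sign of a term of a Plücker relation if the two index
sets have equally many elements strictly between `j s` and `j t`. -/
theorem orderSign_exchange {n m : ℕ} {i : Fin m → Fin n} {j : Fin (m + 2) → Fin n}
    (hi : Function.Injective i) (hj : Function.Injective j) {s t : Fin (m + 2)} (hst : s ≠ t)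
    (his : ∀ x, i x ≠ j s) (hit : ∀ x, i x ≠ j t)
    (hcard : #{z ∈ univ.image (Fin.snoc i (j s) : Fin (m + 1) → Fin n) |
        min (j s) (j t) < z ∧ z < max (j s) (j t)} =
      #{z ∈ univ.image (fun x => j (s.succAbove x)) |
        min (j s) (j t) < z ∧ z < max (j s) (j t)}) :
    (-1) ^ (s : ℕ) * orderSign (fun x => ((Fin.snoc i (j s) : Fin (m + 1) → Fin n) x : ℤ)) *
        orderSign (fun x => (j (s.succAbove x) : ℤ)) =
      -((-1) ^ (t : ℕ) * orderSign (fun x => ((Fin.snoc i (j t) : Fin (m + 1) → Fin n) x : ℤ)) *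
        orderSign (fun x => (j (t.succAbove x) : ℤ))) := by
  have hsnoc : ∀ a : Fin n, (fun x => ((Fin.snoc i a : Fin (m + 1) → Fin n) x : ℤ)) =
      (Fin.snoc (fun x => (i x : ℤ)) (a : ℤ) : Fin (m + 1) → ℤ) := fun a => by
    funext x
    refine Fin.lastCases ?_ (fun y => ?_) x <;> simp
  have hj' : Function.Injective fun x => (j x : ℤ) := fun x y h => hj (Fin.ext (by simpa using h))
  have hW := neg_one_pow_mul_orderSign_succAbove hj'
  simp only [hsnoc, orderSign_snoc]
  -- Up to factors independent of `s`, the term for `s` has sign `A (j s) * B s`. It remains to see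
  -- that these products for `s` and `t` are opposite.
  set A : Fin n → ℤ := fun a => ∏ x, ((i x : ℤ) - a).sign with hA
  set B : Fin (m + 2) → ℤ := fun s => ∏ x, ((j (s.succAbove x) : ℤ) - j s).sign with hB
  have hAA : A (j s) * A (j t) =
      ∏ z ∈ univ.image (Fin.snoc i (j s) : Fin (m + 1) → Fin n), betweenSign (j s) (j t) z := by
    have hinj : Function.Injective (Fin.snoc i (j s) : Fin (m + 1) → Fin n) :=
      Fin.snoc_injective_of_injective hi (fun ⟨x, hx⟩ => his x hx)
    rw [prod_image hinj.injOn, Fin.prod_univ_castSucc, ← prod_mul_distrib]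
    simp only [Fin.snoc_castSucc, Fin.snoc_last, betweenSign_left, mul_one]
    exact prod_congr rfl fun x _ => sign_sub_mul_sign_sub (his x) (hit x)
  have hBB : B s * B t =
      -∏ z ∈ univ.image (fun x => j (s.succAbove x)), betweenSign (j s) (j t) z := by
    have hinj : Function.Injective fun x => j (s.succAbove x) :=
      hj.comp (Fin.succAbove_right_injective)
    rw [prod_image hinj.injOn]
    simp only [hB]
    rw [prod_succAbove_eq_prod_erase (fun y => ((j y : ℤ) - j s).sign) s,
      prod_succAbove_eq_prod_erase (fun y => ((j y : ℤ) - j t).sign) t,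
      prod_succAbove_eq_prod_erase (fun y => betweenSign (j s) (j t) (j y)) s,
      ← mul_prod_erase (univ.erase s) _ (mem_erase.2 ⟨hst.symm, mem_univ t⟩),
      ← mul_prod_erase (univ.erase t) _ (mem_erase.2 ⟨hst, mem_univ s⟩),
      ← mul_prod_erase (univ.erase s) _ (mem_erase.2 ⟨hst.symm, mem_univ t⟩),
      erase_right_comm (a := t), betweenSign_right, one_mul, mul_mul_mul_comm, ← prod_mul_distrib]
    -- Comparing `j s` and `j t` with each other is the source of the sign reversal; all other
    -- factors are between-signs.
    have h1 : ((j t : ℤ) - j s).sign * ((j s : ℤ) - j t).sign = -1 := by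
      rcases lt_or_gt_of_ne (hj'.ne hst) with h | h
      · rw [Int.sign_eq_one_of_pos (sub_pos.2 h), Int.sign_eq_neg_one_of_neg (sub_neg.2 h)]
        rfl
      · rw [Int.sign_eq_one_of_pos (sub_pos.2 h), Int.sign_eq_neg_one_of_neg (sub_neg.2 h)]
        rfl
    rw [h1, neg_one_mul, neg_inj]
    refine prod_congr rfl fun y hy => ?_
    rw [mem_erase, mem_erase] at hy
    exact sign_sub_mul_sign_sub (hj.ne hy.2.1) (hj.ne hy.1)
  have hAB : (A (j s) * B s) * (A (j t) * B t) = -1 := by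
    rw [mul_mul_mul_comm, hAA, hBB, prod_betweenSign, prod_betweenSign, hcard, mul_neg, ← mul_pow]
    simp
  have hAB' : A (j s) * B s = -(A (j t) * B t) := by
    rcases Int.eq_one_or_neg_one_of_mul_eq_neg_one' hAB with ⟨h1, h2⟩ | ⟨h1, h2⟩ <;>
      simp [h1, h2]
  have hs := hW s
  have ht := hW t
  linear_combination (-1) ^ m * A (j s) * orderSign (fun x => (i x : ℤ)) * hs +
    (-1) ^ m * A (j t) * orderSign (fun x => (i x : ℤ)) * ht +
    (-1) ^ m * orderSign (fun x => (i x : ℤ)) * orderSign (fun x => (j x : ℤ)) * hAB'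

end OrderSign

/-! ### Antisymmetric extension of coordinates -/

section AntisymmetricCoord

open Finset

/-- As `orderSign` vanishes on repeated entries, this removes the case distinction and makes sign
computations multiplicative. -/
theorem antisymmetricCoord_eq {n k : ℕ} (p : Finset (Fin n) → ℝ) (f : Fin k → Fin n) :
    antisymmetricCoord p f = (orderSign (fun x => (f x : ℤ)) : ℝ) * p (univ.image f) := by
  classical
  have hval : ∀ {g : Fin k → Fin n}, Function.Injective g ↔
      Function.Injective fun x => (g x : ℤ) := by
    intro g
    have : Function.Injective fun z : Fin n => (z : ℤ) := fun x y h => Fin.ext (by simpa using h)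
    exact (this.of_comp_iff g).symm
  by_cases hf : Function.Injective f
  · have hmono : StrictMono fun x => ((f (Tuple.sort f x) : Fin n) : ℤ) := by
      have h : StrictMono (f ∘ Tuple.sort f) :=
        (Tuple.monotone_sort f).strictMono_of_injective (hf.comp (Tuple.sort f).injective)
      intro x y hxy
      simpa using h hxy
    have h1 := orderSign_comp_perm (fun x => (f x : ℤ)) (Tuple.sort f)
    rw [Function.comp_def, orderSign_strictMono hmono] at h1
    have h2 : ((Equiv.Perm.sign (Tuple.sort f) : ℤ)) = orderSign fun x => (f x : ℤ) := by
      rcases Int.units_eq_one_or (Equiv.Perm.sign (Tuple.sort f)) with h | h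
      · rw [h] at h1 ⊢
        simpa using h1
      · rw [h] at h1 ⊢
        push_cast at h1 ⊢
        omega
    rw [antisymmetricCoord, if_pos hf, h2]
  · rw [antisymmetricCoord, if_neg hf, orderSign_eq_zero (fun h => hf (hval.2 h))]
    simp

theorem antisymmetricCoord_comp_perm {n k : ℕ} (p : Finset (Fin n) → ℝ) (f : Fin k → Fin n)
    (σ : Equiv.Perm (Fin k)) :
    antisymmetricCoord p (f ∘ σ) =
      ((Equiv.Perm.sign σ : ℤ) : ℝ) * antisymmetricCoord p f := by
  classical
  rw [antisymmetricCoord_eq, antisymmetricCoord_eq, ← mul_assoc, ← Int.cast_mul,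
    ← orderSign_comp_perm]
  congr 2
  rw [← image_image, image_univ_equiv]

theorem antisymmetricCoord_of_not_injective {n k : ℕ} (p : Finset (Fin n) → ℝ)
    {f : Fin k → Fin n} (hf : ¬ Function.Injective f) : antisymmetricCoord p f = 0 :=
  if_neg hf

theorem antisymmetricCoord_of_strictMono {n k : ℕ} (p : Finset (Fin n) → ℝ)
    {f : Fin k → Fin n} (hf : StrictMono f) :
    antisymmetricCoord p f = p (univ.image f) := by
  rw [antisymmetricCoord_eq, orderSign_strictMono]
  · simp
  · intro x y hxy
    simpa using hf hxy

/-- A Plücker relation holds trivially if an index is repeated among the `j`. -/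
theorem pluckerSum_eq_zero_of_not_injective {n m : ℕ} (p : Finset (Fin n) → ℝ)
    (i : Fin m → Fin n) {j : Fin (m + 2) → Fin n} (hj : ¬ Function.Injective j) :
    ∑ s : Fin (m + 2), (-1 : ℝ) ^ (s : ℕ) *
      antisymmetricCoord p (Fin.snoc (α := fun _ => Fin n) i (j s)) *
      antisymmetricCoord p (fun t : Fin (m + 1) => j (s.succAbove t)) = 0 := by
  classical
  simp only [Function.Injective, not_forall] at hj
  obtain ⟨s, t, hjst, hst⟩ := hj
  have himage : ∀ s t, j s = j t → s ≠ t →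
      univ.image (fun x => j (s.succAbove x)) = univ.image j := by
    intro s t hjst hst
    ext z
    simp only [mem_image, mem_univ, true_and]
    constructor
    · rintro ⟨x, rfl⟩
      exact ⟨_, rfl⟩
    · rintro ⟨y, rfl⟩
      by_cases hy : y = s
      · obtain ⟨x, hx⟩ := Fin.exists_succAbove_eq hst.symm
        exact ⟨x, by rw [hx, hy, hjst]⟩
      · obtain ⟨x, hx⟩ := Fin.exists_succAbove_eq hy
        exact ⟨x, by rw [hx]⟩
  -- Omitting any other slot leaves both equal indices in place, so only the terms for `s` and `t`
  -- survive, and they cancel.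
  rw [sum_eq_add s t hst]
  · have h := neg_one_pow_mul_orderSign_succAbove_of_eq (f := fun x => (j x : ℤ)) hst
      (by rw [hjst])
    have h' := congrArg (Int.cast : ℤ → ℝ) h
    push_cast at h'
    rw [antisymmetricCoord_eq p fun x => j (s.succAbove x),
      antisymmetricCoord_eq p fun x => j (t.succAbove x), himage s t hjst hst,
      himage t s hjst.symm (Ne.symm hst), hjst]
    linear_combination (antisymmetricCoord p (Fin.snoc (α := fun _ => Fin n) i (j t)) *
      p (univ.image j)) * h'
  · rintro u - ⟨hus, hut⟩
    rw [antisymmetricCoord_of_not_injective p (f := fun x => j (u.succAbove x)), mul_zero]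
    intro h
    obtain ⟨x, hx⟩ := Fin.exists_succAbove_eq hus.symm
    obtain ⟨y, hy⟩ := Fin.exists_succAbove_eq hut.symm
    have : x = y := h (by simp only [hx, hy, hjst])
    exact hst (by rw [← hx, ← hy, this])
  · simp
  · simp

end AntisymmetricCoord

/-! ### From Plücker relations to a unique subspace -/

section PluckerEmbedding

open Finset

/-- An alternating function of finite sequences of indices is determined by its values at strictly
increasing sequences. -/
theorem eq_of_alternating_of_strictMono {n k : ℕ} {Q Q' : (Fin k → Fin n) → ℂ}
    (hQ : ∀ f (σ : Equiv.Perm (Fin k)), Q (f ∘ σ) = ((Equiv.Perm.sign σ : ℤ) : ℂ) * Q f)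
    (hQ' : ∀ f (σ : Equiv.Perm (Fin k)), Q' (f ∘ σ) = ((Equiv.Perm.sign σ : ℤ) : ℂ) * Q' f)
    (h0 : ∀ f, ¬ Function.Injective f → Q f = 0) (h0' : ∀ f, ¬ Function.Injective f → Q' f = 0)
    (h : ∀ f, StrictMono f → Q f = Q' f) : Q = Q' := by
  funext f
  by_cases hf : Function.Injective f
  · have hm : StrictMono (f ∘ Tuple.sort f) :=
      (Tuple.monotone_sort f).strictMono_of_injective (hf.comp (Tuple.sort f).injective)
    have h1 := h _ hm
    rw [hQ, hQ'] at h1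
    exact mul_left_cancel₀ (by simp) h1
  · rw [h0 f hf, h0' f hf]

theorem det_submatrix_comp_perm {n k : ℕ} (M : Matrix (Fin k) (Fin n) ℂ) (f : Fin k → Fin n)
    (σ : Equiv.Perm (Fin k)) :
    (M.submatrix id (f ∘ σ)).det =
      ((Equiv.Perm.sign σ : ℤ) : ℂ) * (M.submatrix id f).det := by
  have := Matrix.det_permute' σ (M.submatrix id f)
  simpa [Matrix.submatrix_submatrix] using this

theorem det_submatrix_of_not_injective {n k : ℕ} (M : Matrix (Fin k) (Fin n) ℂ)
    {f : Fin k → Fin n} (hf : ¬ Function.Injective f) : (M.submatrix id f).det = 0 := by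
  simp only [Function.Injective, not_forall] at hf
  obtain ⟨x, y, hxy, hne⟩ := hf
  exact Matrix.det_zero_of_column_eq hne fun a => by simp [hxy]

theorem antisymmetricCoord_eq_det {n k : ℕ} {p : Finset (Fin n) → ℝ}
    {M : Matrix (Fin k) (Fin n) ℂ} {c : ℂ}
    (h : ∀ (I : Finset (Fin n)) (hI : I.card = k),
      (p I : ℂ) = c * (M.submatrix id (I.orderEmbOfFin hI)).det) (f : Fin k → Fin n) :
    (antisymmetricCoord p f : ℂ) = c * (M.submatrix id f).det := by
  classical
  refine congrFun (eq_of_alternating_of_strictMono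
    (Q := fun f => (antisymmetricCoord p f : ℂ)) (Q' := fun f => c * (M.submatrix id f).det)
    (fun f σ => ?_) (fun f σ => ?_) (fun f hf => ?_) (fun f hf => ?_) (fun f hf => ?_)) f
  · rw [antisymmetricCoord_comp_perm]
    push_cast
    rfl
  · rw [det_submatrix_comp_perm, mul_left_comm]
  · rw [antisymmetricCoord_of_not_injective p hf]
    simp
  · rw [det_submatrix_of_not_injective M hf, mul_zero]
  · have hcard : (univ.image f).card = k := by
      rw [card_image_of_injective _ hf.injective, card_univ, Fintype.card_fin]
    rw [antisymmetricCoord_of_strictMono p hf, h _ hcard,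
      ← orderEmbOfFin_unique hcard (f := f) (fun x => mem_image_of_mem f (mem_univ x)) hf]

/-- The `k × n` matrix, in reduced form with respect to the columns `g`, whose entries are the
coordinates of the sequences that differ from `g` in at most one place. -/
noncomputable def reducedMatrix {n k : ℕ} (p : Finset (Fin n) → ℝ) (g : Fin k → Fin n) :
    Matrix (Fin k) (Fin n) ℂ :=
  Matrix.of fun a b =>
    (antisymmetricCoord p (Function.update g a b) : ℂ) / antisymmetricCoord p g

theorem reducedMatrix_apply {n k : ℕ} (p : Finset (Fin n) → ℝ) (g : Fin k → Fin n) (a : Fin k)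
    (b : Fin n) : reducedMatrix p g a b =
      (antisymmetricCoord p (Function.update g a b) : ℂ) / antisymmetricCoord p g := rfl

theorem updateCol_submatrix {n k : ℕ} (M : Matrix (Fin k) (Fin n) ℂ) (g : Fin k → Fin n)
    (a : Fin k) (b : Fin n) :
    (M.submatrix id g).updateCol a (fun r => M r b) =
      M.submatrix id (Function.update g a b) := by
  ext r c
  by_cases hc : c = a
  · subst hc
    simp
  · simp [Matrix.updateCol_ne hc, Function.update_of_ne hc]

/-- The row span of a matrix is determined by its maximal minors. -/
theorem span_rows_eq_of_isPluckerCoordinates {n k : ℕ} {p : Finset (Fin n) → ℝ}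
    {X : ComplexGrassmannian k n} (hX : IsPluckerCoordinates X p) {g : Fin k → Fin n}
    (hg : antisymmetricCoord p g ≠ 0) :
    X.1 = Submodule.span ℂ (Set.range fun a => reducedMatrix p g a) := by
  obtain ⟨M, hM, c, hc, hp⟩ := hX
  have hdet := antisymmetricCoord_eq_det hp
  set N := M.submatrix id g with hN
  have hg' : (antisymmetricCoord p g : ℂ) ≠ 0 := by exact_mod_cast hg
  have hN0 : N.det ≠ 0 := by
    intro h
    rw [hdet, ← hN, h, mul_zero] at hg'
    exact hg' rfl
  -- Cramer's rule: the entries of `reducedMatrix p g` are quotients of minors of `M`, from which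
  -- the common scalar `c` cancels.
  have hmul : N * reducedMatrix p g = M := by
    ext r b
    have h1 := congrFun (Matrix.mulVec_cramer N fun r => M r b) r
    rw [Matrix.mulVec, dotProduct] at h1
    simp only [Matrix.cramer_apply, hN, updateCol_submatrix] at h1
    rw [Matrix.mul_apply]
    simp only [reducedMatrix_apply, hdet, ← hN] at h1 ⊢
    simp only [mul_div_mul_left _ _ hc, ← mul_div_assoc]
    rw [← sum_div, h1, Pi.smul_apply, smul_eq_mul, mul_div_cancel_left₀ _ hN0]
  have hsurj : Function.Surjective N.vecMulLinear := by
    intro v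
    refine ⟨Matrix.vecMul v N⁻¹, ?_⟩
    rw [Matrix.vecMulLinear_apply, Matrix.vecMul_vecMul,
      Matrix.nonsing_inv_mul _ (isUnit_iff_ne_zero.2 hN0), Matrix.vecMul_one]
  have hrange : LinearMap.range M.vecMulLinear =
      LinearMap.range (reducedMatrix p g).vecMulLinear := by
    have : M.vecMulLinear = (reducedMatrix p g).vecMulLinear ∘ₗ N.vecMulLinear := by
      refine LinearMap.ext fun v => ?_
      simp [← hmul, Matrix.vecMul_vecMul]
    rw [this, LinearMap.range_comp_of_range_eq_top _ (LinearMap.range_eq_top.2 hsurj)]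
  rw [range_vecMulLinear, range_vecMulLinear] at hrange
  rw [← hM]
  exact hrange

/-- The exchange form of the Plücker relations. -/
theorem PluckerRelations.exchange {n k : ℕ} {p : Finset (Fin n) → ℝ} (hp : PluckerRelations k p)
    (f g : Fin k → Fin n) (x : Fin k) :
    antisymmetricCoord p f * antisymmetricCoord p g =
      ∑ s, antisymmetricCoord p (Function.update f x (g s)) *
        antisymmetricCoord p (Function.update g s (f x)) := by
  obtain _ | m := k
  · exact x.elim0
  -- With `f x` removed from the first sequence and put in front of `g`, the term `s = 0` becomes
  -- the left-hand side and the others the exchanges.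
  have h := hp m rfl (fun y => f (x.succAbove y)) (Fin.cons (f x) g)
  have hcons : ∀ (f : Fin (m + 1) → Fin n) (x : Fin (m + 1)) (a : Fin n),
      antisymmetricCoord p (Fin.cons a (fun y => f (x.succAbove y)) : Fin (m + 1) → Fin n) =
        (-1) ^ (x : ℕ) * antisymmetricCoord p (Function.update f x a) := by
    intro f x a
    rw [← update_comp_cycleRange_symm, antisymmetricCoord_comp_perm, Equiv.Perm.sign_symm,
      Fin.sign_cycleRange]
    simp
  have hsnoc : ∀ a, antisymmetricCoord p
      (Fin.snoc (α := fun _ => Fin n) (fun y => f (x.succAbove y)) a) =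
        (-1) ^ m * ((-1) ^ (x : ℕ) * antisymmetricCoord p (Function.update f x a)) := by
    intro a
    rw [Fin.snoc_eq_cons_rotate, ← hcons]
    have := antisymmetricCoord_comp_perm p
      (Fin.cons a (fun y => f (x.succAbove y)) : Fin (m + 1) → Fin n) (finRotate (m + 1))
    rw [sign_finRotate] at this
    simpa [Function.comp_def] using this
  have hsucc : ∀ s : Fin (m + 1), (fun t : Fin (m + 1) =>
      (Fin.cons (f x) g : Fin (m + 2) → Fin n) (s.succ.succAbove t)) =
        (Fin.cons (f x) (fun y => g (s.succAbove y)) : Fin (m + 1) → Fin n) := by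
    intro s
    funext t
    refine Fin.cases ?_ (fun y => ?_) t
    · simp
    · simp
  rw [Fin.sum_univ_succ] at h
  simp only [hsnoc, hsucc, hcons, Fin.cons_zero, Fin.cons_succ, Fin.succAbove_zero,
    Function.update_eq_self, Fin.val_zero, pow_zero, one_mul, Fin.val_succ] at h
  have hterm : ∀ s : Fin (m + 1), (-1 : ℝ) ^ ((s : ℕ) + 1) *
      ((-1) ^ m * ((-1) ^ (x : ℕ) * antisymmetricCoord p (Function.update f x (g s)))) *
      ((-1) ^ (s : ℕ) * antisymmetricCoord p (Function.update g s (f x))) =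
      -((-1) ^ m * (-1) ^ (x : ℕ)) * (antisymmetricCoord p (Function.update f x (g s)) *
        antisymmetricCoord p (Function.update g s (f x))) := by
    intro s
    have h1 : (-1 : ℝ) ^ (s : ℕ) * (-1) ^ (s : ℕ) = 1 := by
      rw [← mul_pow]
      simp
    rw [pow_succ]
    linear_combination -((-1 : ℝ) ^ m * (-1) ^ (x : ℕ) *
      antisymmetricCoord p (Function.update f x (g s)) *
      antisymmetricCoord p (Function.update g s (f x))) * h1
  rw [sum_congr rfl fun s _ => hterm s, ← mul_sum] at h
  have h2 : ((-1 : ℝ) ^ m * (-1) ^ (x : ℕ)) ≠ 0 := by simp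
  refine mul_left_cancel₀ h2 ?_
  linear_combination h

theorem reducedMatrix_submatrix {n k : ℕ} {p : Finset (Fin n) → ℝ} {g : Fin k → Fin n}
    (hg : antisymmetricCoord p g ≠ 0) : (reducedMatrix p g).submatrix id g = 1 := by
  have hg' : (antisymmetricCoord p g : ℂ) ≠ 0 := by exact_mod_cast hg
  ext a b
  rw [Matrix.submatrix_apply, reducedMatrix_apply, id]
  by_cases hab : a = b
  · subst hab
    rw [Function.update_eq_self, Matrix.one_apply_eq, div_self hg']
  · rw [Matrix.one_apply_ne hab, antisymmetricCoord_of_not_injective]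
    · simp
    · intro h
      exact hab (h (by rw [Function.update_self, Function.update_of_ne (Ne.symm hab)]))

/-- Both sides obey the same recursion: replacing an index outside `g` by the entries of `g` is the
exchange relation on the left and the expansion of a column in unit columns on the right. The
induction is on the number of positions of `f` with value outside `g`. -/
theorem det_reducedMatrix_submatrix {n k : ℕ} {p : Finset (Fin n) → ℝ}
    (hp : PluckerRelations k p) {g : Fin k → Fin n} (hg : antisymmetricCoord p g ≠ 0)
    (f : Fin k → Fin n) :
    (antisymmetricCoord p f : ℂ) =
      antisymmetricCoord p g * ((reducedMatrix p g).submatrix id f).det := by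
  classical
  have hg' : (antisymmetricCoord p g : ℂ) ≠ 0 := by exact_mod_cast hg
  have hginj : Function.Injective g := by
    by_contra h
    exact hg (antisymmetricCoord_of_not_injective p h)
  induction hd : #{x | f x ∉ univ.image g} generalizing f with
  | zero =>
    by_cases hf : Function.Injective f
    · have hmem : ∀ x, ∃ y, g y = f x := by
        intro x
        by_contra hx
        have : x ∈ ({x | f x ∉ univ.image g} : Finset (Fin k)) := by simpa using hx
        rw [card_eq_zero.1 hd] at this
        simp at this
      choose σ hσ using hmem
      have hσinj : Function.Injective σ := fun x y h => hf (by rw [← hσ, ← hσ, h])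
      obtain ⟨τ, hτ⟩ : ∃ τ : Equiv.Perm (Fin k), ⇑τ = σ :=
        ⟨Equiv.ofBijective σ (Finite.injective_iff_bijective.1 hσinj), rfl⟩
      have hfσ : f = g ∘ τ := by
        funext x
        rw [Function.comp_apply, hτ, hσ]
      rw [hfσ, det_submatrix_comp_perm, antisymmetricCoord_comp_perm, reducedMatrix_submatrix hg]
      push_cast
      simp [mul_comm]
    · rw [antisymmetricCoord_of_not_injective p hf, det_submatrix_of_not_injective _ hf]
      simp
  | succ d ih =>
    obtain ⟨x, hx⟩ : ({x | f x ∉ univ.image g} : Finset (Fin k)).Nonempty := by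
      rw [← card_pos]
      omega
    have hstep : ∀ s, (antisymmetricCoord p (Function.update f x (g s)) : ℂ) =
        antisymmetricCoord p g *
          ((reducedMatrix p g).submatrix id (Function.update f x (g s))).det := by
      intro s
      apply ih
      have : ({y | Function.update f x (g s) y ∉ univ.image g} : Finset (Fin k)) =
          ({x | f x ∉ univ.image g} : Finset (Fin k)).erase x := by
        ext y
        rw [mem_erase, mem_filter_univ, mem_filter_univ]
        by_cases hy : y = x
        · subst hy
          simp
        · simp [hy]
      rw [this, card_erase_of_mem hx, hd, Nat.add_sub_cancel]
    have hexch := congrArg (Complex.ofReal) (hp.exchange f g x)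
    push_cast at hexch
    have hcol : (fun r => reducedMatrix p g r (f x)) =
        ∑ s, reducedMatrix p g s (f x) • fun r => reducedMatrix p g r (g s) := by
      funext r
      have h1 : ∀ s, reducedMatrix p g r (g s) = if r = s then 1 else 0 := fun s => by
        have := congrFun (congrFun (reducedMatrix_submatrix hg) r) s
        rwa [Matrix.one_apply] at this
      simp [h1]
    have hexpand : ((reducedMatrix p g).submatrix id f).det =
        ∑ s, reducedMatrix p g s (f x) *
          ((reducedMatrix p g).submatrix id (Function.update f x (g s))).det := by
      have h1 := updateCol_submatrix (reducedMatrix p g) f x (f x)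
      rw [Function.update_eq_self] at h1
      rw [← h1, ← Matrix.cramer_apply, hcol, map_sum, Finset.sum_apply]
      refine sum_congr rfl fun s _ => ?_
      rw [map_smul, Pi.smul_apply, smul_eq_mul, Matrix.cramer_apply, updateCol_submatrix]
    refine mul_right_cancel₀ hg' ?_
    rw [hexch, hexpand, mul_sum, sum_mul]
    refine sum_congr rfl fun s _ => ?_
    rw [hstep, reducedMatrix_apply]
    field_simp

/-- Numbers that satisfy the Plücker relations and do not all vanish are the Plücker coordinates of
exactly one subspace. -/
theorem PluckerRelations.existsUnique_subspace {n k : ℕ} {p : Finset (Fin n) → ℝ}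
    (hp : PluckerRelations k p) {I : Finset (Fin n)} (hI : I.card = k) (hpI : p I ≠ 0) :
    ∃! X : ComplexGrassmannian k n, IsPluckerCoordinates X p := by
  classical
  have hval : ∀ (J : Finset (Fin n)) (hJ : J.card = k),
      antisymmetricCoord p (J.orderEmbOfFin hJ) = p J := fun J hJ => by
    rw [antisymmetricCoord_of_strictMono p (J.orderEmbOfFin hJ).strictMono]
    congr 1
    rw [image_orderEmbOfFin_univ]
  obtain ⟨g, hg⟩ : ∃ g : Fin k → Fin n, antisymmetricCoord p g ≠ 0 :=
    ⟨_, by rwa [hval I hI]⟩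
  -- The columns `g` form the identity, so a row combination shows its own coefficients there.
  have hli : LinearIndependent ℂ (reducedMatrix p g).row := by
    rw [← Matrix.vecMul_injective_iff]
    intro v w hvw
    funext b
    have h1 : ∀ v : Fin k → ℂ, Matrix.vecMul v (reducedMatrix p g) (g b) = v b := fun v => by
      have : Matrix.vecMul v (reducedMatrix p g) (g b) =
          Matrix.vecMul v ((reducedMatrix p g).submatrix id g) b := rfl
      rw [this, reducedMatrix_submatrix hg, Matrix.vecMul_one]
    rw [← h1 v, ← h1 w]
    exact congrFun hvw (g b)
  refine ⟨⟨Submodule.span ℂ (Set.range fun a => reducedMatrix p g a), ?_⟩, ?_, ?_⟩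
  · have := finrank_span_eq_card hli
    rw [Fintype.card_fin] at this
    exact this
  · refine ⟨reducedMatrix p g, rfl, antisymmetricCoord p g, by exact_mod_cast hg, ?_⟩
    intro J hJ
    rw [← det_reducedMatrix_submatrix hp hg, hval]
  · intro Y hY
    exact Subtype.ext (span_rows_eq_of_isPluckerCoordinates hY hg)

end PluckerEmbedding

/-! ### Orbits of a product of two involutions -/

section Involutions

/-- If `ρ` and `s` are involutions of a finite set and `ρ` has no fixed points, then an orbit of
`ρ * s` that contains a fixed point of `s` contains exactly two of them; moreover
the orbit is closed under `ρ` and `s`. -/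
theorem exists_other_fixed_point {H : Type*} [Finite H] {ρ s : Equiv.Perm H} (hρ : ρ * ρ = 1)
    (hs : s * s = 1) (hfree : ∀ x, ρ x ≠ x) {h : H} (hh : s h = h) :
    ∃ h', h' ≠ h ∧ (ρ * s).SameCycle h h' ∧ s h' = h' ∧
      (∀ x, (ρ * s).SameCycle h x → s x = x → x = h ∨ x = h') ∧
      ∀ x, (ρ * s).SameCycle h x → (ρ * s).SameCycle h (s x) ∧ (ρ * s).SameCycle h (ρ x) := by
  set w := ρ * s with hw
  have hsinv : s⁻¹ = s := inv_eq_of_mul_eq_one_left hs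
  have hρinv : ρ⁻¹ = ρ := inv_eq_of_mul_eq_one_left hρ
  have hconj : s * w * s⁻¹ = w⁻¹ := by
    rw [hw, mul_inv_rev, hsinv, hρinv, ← mul_assoc, mul_assoc (s * ρ), hs, mul_one]
  -- The orbit of `h` is a copy of the integers modulo its period, on which `s` acts by `i ↦ -i` and
  -- `ρ` by `i ↦ 1 - i`.
  have hsw : ∀ i : ℤ, s ((w ^ i) h) = (w ^ (-i)) h := by
    intro i
    have h1 : s * w ^ i * s⁻¹ = w ^ (-i) := by
      rw [← conj_zpow, hconj, inv_zpow, zpow_neg]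
    rw [← h1, Equiv.Perm.mul_apply, Equiv.Perm.mul_apply, hsinv, hh]
  have hρw : ∀ i : ℤ, ρ ((w ^ i) h) = (w ^ (1 - i)) h := by
    intro i
    have h1 : ∀ y, ρ y = w (s y) := fun y => by
      rw [hw, ← Equiv.Perm.mul_apply, mul_assoc, hs, mul_one]
    rw [h1, hsw, sub_eq_add_neg, zpow_add, zpow_one]
    rfl
  set m := Function.minimalPeriod (w • ·) h with hm
  have hdvd : ∀ i : ℤ, (w ^ i) h = h ↔ (m : ℤ) ∣ i := fun i => by
    rw [← Equiv.Perm.smul_def]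
    exact MulAction.zpow_smul_eq_iff_minimalPeriod_dvd
  have heq : ∀ i j : ℤ, (w ^ i) h = (w ^ j) h ↔ (m : ℤ) ∣ i - j := by
    intro i j
    rw [← hdvd, sub_eq_neg_add, zpow_add, Equiv.Perm.mul_apply, zpow_neg,
      Equiv.Perm.inv_eq_iff_eq]
  have hm0 : 0 < m := by
    have : h ∈ Function.periodicPts (w • ·) :=
      Function.Injective.mem_periodicPts (MulAction.injective w) h
    exact Function.minimalPeriod_pos_of_mem_periodicPts this
  -- An odd period would let `2 * i = 1` be solved, giving `ρ` a fixed point. For period `2 * l` the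
  -- fixed points of `s` are at 0 and `l`.
  obtain ⟨l, hl | hl⟩ := Nat.even_or_odd' m
  rotate_left
  · exfalso
    refine hfree ((w ^ ((l : ℤ) + 1)) h) ?_
    rw [hρw, heq]
    exact ⟨-1, by rw [hl]; push_cast; ring⟩
  · have hl0 : 0 < l := by omega
    refine ⟨(w ^ (l : ℤ)) h, ?_, ⟨l, rfl⟩, ?_, ?_, ?_⟩
    · rw [Ne, hdvd, hl]
      intro h1
      have := Int.le_of_dvd (by omega) h1
      push_cast at this
      omega
    · rw [hsw, heq]
      exact ⟨-1, by rw [hl]; push_cast; ring⟩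
    · rintro x ⟨i, rfl⟩ hx
      rw [hsw, heq, hl] at hx
      obtain ⟨q, hq⟩ := hx
      have hi : i = l * (-q) := by
        push_cast at hq
        have : (2 : ℤ) * i = 2 * (l * (-q)) := by linear_combination -hq
        omega
      rcases Int.even_or_odd' q with ⟨r, hr | hr⟩
      · left
        rw [hdvd, hl]
        exact ⟨-r, by rw [hi, hr]; push_cast; ring⟩
      · right
        rw [heq, hl]
        exact ⟨-r - 1, by rw [hi, hr]; push_cast; ring⟩
    · rintro x ⟨i, rfl⟩
      exact ⟨⟨-i, (hsw i).symm⟩, ⟨1 - i, (hρw i).symm⟩⟩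

end Involutions

/-! ### Darts and the paths of a path system -/

namespace BipartiteNetwork

variable {n : ℕ} {V E : Type*} (N : BipartiteNetwork n V E)

section Darts

/-- The end point of an edge on its black side (`true`) or on its white side (`false`). -/
def dartEnd (h : E × Bool) : V ⊕ Fin n :=
  cond h.2 (N.blackEnd h.1) (N.whiteEnd h.1)

theorem incident_iff_dartEnd {e : E} {x : V ⊕ Fin n} :
    N.Incident e x ↔ ∃ b, N.dartEnd (e, b) = x := by
  simp [Incident, dartEnd, or_comm]

theorem incident_dartEnd (h : E × Bool) : N.Incident h.1 (N.dartEnd h) :=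
  N.incident_iff_dartEnd.2 ⟨h.2, rfl⟩

theorem color_dartEnd (h : E × Bool) :
    N.color (N.dartEnd h) = cond h.2 VertexColor.black VertexColor.white := by
  obtain ⟨e, _ | _⟩ := h
  · exact N.color_whiteEnd e
  · exact N.color_blackEnd e

/-- The colour of a vertex determines the side on which edges meet it. Hence `nextDart` can keep the
Boolean unchanged. -/
theorem side_eq_of_dartEnd_eq {h h' : E × Bool} (heq : N.dartEnd h = N.dartEnd h') :
    h.2 = h'.2 := by
  have h1 := N.color_dartEnd h
  rw [heq, color_dartEnd] at h1
  revert h1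
  cases h.2 <;> cases h'.2 <;> simp

theorem dartEnd_eq_of_incident {e e' : E} {b : Bool} {x : V ⊕ Fin n}
    (h : N.dartEnd (e, b) = x) (h' : N.Incident e' x) : N.dartEnd (e', b) = x := by
  obtain ⟨b', hb'⟩ := N.incident_iff_dartEnd.1 h'
  have : b' = b := N.side_eq_of_dartEnd_eq (hb'.trans h.symm)
  rwa [this] at hb'

/-- The edge at a boundary vertex. -/
noncomputable def boundaryEdge (i : Fin n) : E :=
  (N.boundary_degree i).choose

theorem incident_boundaryEdge (i : Fin n) : N.Incident (N.boundaryEdge i) (Sum.inr i) :=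
  (N.boundary_degree i).choose_spec.1

theorem eq_boundaryEdge {i : Fin n} {e : E} (h : N.Incident e (Sum.inr i)) :
    e = N.boundaryEdge i :=
  (N.boundary_degree i).choose_spec.2 e h

theorem boundary_eq_of_incident {e : E} {i j : Fin n} (hi : N.Incident e (Sum.inr i))
    (hj : N.Incident e (Sum.inr j)) : i = j := by
  rcases hi with hi | hi <;> rcases hj with hj | hj
  · exact Sum.inr_injective (hi.symm.trans hj)
  · exact absurd ⟨hi, hj⟩ (N.not_boundary_boundary e i j)
  · exact absurd ⟨hj, hi⟩ (N.not_boundary_boundary e j i)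
  · exact Sum.inr_injective (hi.symm.trans hj)

theorem boundaryEdge_injective : Function.Injective N.boundaryEdge := fun i j h =>
  N.boundary_eq_of_incident (N.incident_boundaryEdge i) (h ▸ N.incident_boundaryEdge j)

end Darts

section Linked

/-- Two edges of `D` that share an interior vertex. -/
def Adjacent (D : Finset E) (e e' : E) : Prop :=
  e ∈ D ∧ e' ∈ D ∧ ∃ v : V, N.Incident e (Sum.inl v) ∧ N.Incident e' (Sum.inl v)

/-- Two edges are linked if they are joined by a chain of edges of `D` in which consecutive edges
share an interior vertex. -/
def Linked (D : Finset E) : E → E → Prop :=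
  Relation.ReflTransGen (N.Adjacent D)

variable {N} {D : Finset E}

theorem Adjacent.symm {e e' : E} (h : N.Adjacent D e e') : N.Adjacent D e' e :=
  ⟨h.2.1, h.1, h.2.2.imp fun _ hv => hv.symm⟩

theorem Linked.symm {e e' : E} (h : N.Linked D e e') : N.Linked D e' e := by
  have : Std.Symm (N.Adjacent D) := ⟨fun _ _ h => h.symm⟩
  exact symm_of (Relation.ReflTransGen (N.Adjacent D)) h

theorem Linked.trans {e e' e'' : E} (h : N.Linked D e e') (h' : N.Linked D e' e'') :
    N.Linked D e e'' :=
  Relation.ReflTransGen.trans h h'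

theorem Linked.mem {e e' : E} (h : N.Linked D e e') (he : e ∈ D) : e' ∈ D := by
  rcases Relation.ReflTransGen.cases_tail h with h | ⟨_, _, h⟩
  · exact h ▸ he
  · exact h.2.1

theorem Adjacent.linked {e e' : E} (h : N.Adjacent D e e') : N.Linked D e e' :=
  Relation.ReflTransGen.single h

variable (N D) in
/-- Every interior vertex that is incident to an edge of `D` is incident to exactly two of them. -/
def IsPathSystem : Prop :=
  ∀ e ∈ D, ∀ v : V, N.Incident e (Sum.inl v) →
    ∃! e', e' ≠ e ∧ e' ∈ D ∧ N.Incident e' (Sum.inl v)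

open scoped Classical in
variable (N D) in
/-- The dart that continues a path at the end point of a dart, if this is an interior vertex. -/
noncomputable def nextDart (h : E × Bool) : E × Bool :=
  if hh : ∃ e', e' ≠ h.1 ∧ h.1 ∈ D ∧ e' ∈ D ∧ ∃ v : V,
      N.dartEnd h = Sum.inl v ∧ N.Incident e' (Sum.inl v) then (hh.choose, h.2)
  else h

theorem nextDart_eq (hD : N.IsPathSystem D) {e e' : E} {b : Bool} {v : V} (he : e ∈ D)
    (hv : N.dartEnd (e, b) = Sum.inl v) (hne : e' ≠ e) (he' : e' ∈ D)
    (hv' : N.Incident e' (Sum.inl v)) : N.nextDart D (e, b) = (e', b) := by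
  have hh : ∃ e', e' ≠ e ∧ e ∈ D ∧ e' ∈ D ∧ ∃ v : V,
      N.dartEnd (e, b) = Sum.inl v ∧ N.Incident e' (Sum.inl v) := ⟨e', hne, he, he', v, hv, hv'⟩
  rw [nextDart, dif_pos hh]
  congr 1
  obtain ⟨h1, -, h2, w, h3, h4⟩ := hh.choose_spec
  have : w = v := Sum.inl_injective (h3.symm.trans hv)
  subst this
  exact (hD e he w (N.incident_iff_dartEnd.2 ⟨b, hv⟩)).unique ⟨h1, h2, h4⟩ ⟨hne, he', hv'⟩

theorem nextDart_of_not_mem {h : E × Bool} (hh : h.1 ∉ D) : N.nextDart D h = h := by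
  rw [nextDart, dif_neg]
  rintro ⟨e', -, h1, -⟩
  exact hh h1

theorem nextDart_of_boundary {h : E × Bool} {i : Fin n} (hi : N.dartEnd h = Sum.inr i) :
    N.nextDart D h = h := by
  rw [nextDart, dif_neg]
  rintro ⟨e', -, -, -, v, h1, -⟩
  rw [hi] at h1
  cases h1

theorem nextDart_cases (hD : N.IsPathSystem D) (h : E × Bool) :
    h.1 ∉ D ∨ (∃ i, N.dartEnd h = Sum.inr i) ∨ ∃ e' v, h.1 ∈ D ∧ e' ∈ D ∧ e' ≠ h.1 ∧
      N.dartEnd h = Sum.inl v ∧ N.Incident e' (Sum.inl v) ∧ N.nextDart D h = (e', h.2) := by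
  by_cases hh : h.1 ∈ D
  · right
    rcases hv : N.dartEnd h with v | i
    · right
      obtain ⟨e', ⟨h1, h2, h3⟩, -⟩ := hD h.1 hh v (N.incident_iff_dartEnd.2 ⟨h.2, hv⟩)
      exact ⟨e', v, hh, h2, h1, rfl, h3, nextDart_eq hD hh hv h1 h2 h3⟩
    · exact Or.inl ⟨i, rfl⟩
  · exact Or.inl hh

theorem nextDart_involutive (hD : N.IsPathSystem D) : Function.Involutive (N.nextDart D) := by
  intro h
  rcases nextDart_cases hD h with h1 | ⟨i, h1⟩ | ⟨e', v, h1, h2, h3, h4, h5, h6⟩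
  · rw [nextDart_of_not_mem h1, nextDart_of_not_mem h1]
  · rw [nextDart_of_boundary h1, nextDart_of_boundary h1]
  · rw [h6]
    exact nextDart_eq hD h2 (N.dartEnd_eq_of_incident h4 h5) h3.symm h1
      (N.incident_iff_dartEnd.2 ⟨h.2, h4⟩)

theorem linked_nextDart (hD : N.IsPathSystem D) (h : E × Bool) :
    N.Linked D h.1 (N.nextDart D h).1 := by
  rcases nextDart_cases hD h with h1 | ⟨i, h1⟩ | ⟨e', v, h1, h2, h3, h4, h5, h6⟩
  · rw [nextDart_of_not_mem h1]
    exact Relation.ReflTransGen.refl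
  · rw [nextDart_of_boundary h1]
    exact Relation.ReflTransGen.refl
  · rw [h6]
    exact Adjacent.linked ⟨h1, h2, v, N.incident_iff_dartEnd.2 ⟨h.2, h4⟩, h5⟩

theorem exists_boundary_of_nextDart_eq (hD : N.IsPathSystem D) {h : E × Bool} (hh : h.1 ∈ D)
    (hfix : N.nextDart D h = h) : ∃ i, N.dartEnd h = Sum.inr i := by
  rcases nextDart_cases hD h with h1 | h1 | ⟨e', v, h1, h2, h3, h4, h5, h6⟩
  · exact absurd hh h1
  · exact h1
  · rw [h6] at hfix
    exact absurd (congrArg Prod.fst hfix) h3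

/-- The path of a path system that starts at a boundary vertex ends at exactly one other boundary
vertex. -/
theorem exists_path_end [Finite E] (hD : N.IsPathSystem D) {i : Fin n}
    (hi : N.boundaryEdge i ∈ D) :
    ∃ i', i' ≠ i ∧ N.Linked D (N.boundaryEdge i) (N.boundaryEdge i') ∧
      ∀ i'', N.Linked D (N.boundaryEdge i) (N.boundaryEdge i'') → i'' = i ∨ i'' = i' := by
  have hflip : Function.Involutive fun h : E × Bool => (h.1, !h.2) := fun h => by simp
  -- Walking along a path alternates between crossing an edge (`ρ`) and passing through a vertex
  -- (`s`). Within `D`, the fixed points of `s` are the darts at the boundary, so a path with one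
  -- boundary end has exactly two.
  set ρ : Equiv.Perm (E × Bool) := hflip.toPerm
  set s : Equiv.Perm (E × Bool) := (nextDart_involutive hD).toPerm
  have hρ : ρ * ρ = 1 := Equiv.ext fun h => hflip h
  have hs : s * s = 1 := Equiv.ext fun h => nextDart_involutive hD h
  obtain ⟨b, hb⟩ := N.incident_iff_dartEnd.1 (N.incident_boundaryEdge i)
  set h₀ : E × Bool := (N.boundaryEdge i, b) with hh₀
  have hs₀ : s h₀ = h₀ := nextDart_of_boundary hb
  obtain ⟨h', hne, hcyc, hfix, huniq, hclosed⟩ := exists_other_fixed_point hρ hs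
    (fun x hx => Bool.not_ne_self x.2 (congrArg Prod.snd hx)) hs₀
  have hstep : ∀ h, N.Linked D h.1 ((ρ * s) h).1 := fun h => linked_nextDart hD h
  have hlink : ∀ h, (ρ * s).SameCycle h₀ h → N.Linked D h₀.1 h.1 := by
    rintro h ⟨k, rfl⟩
    induction k using Int.induction_on with
    | zero => exact Relation.ReflTransGen.refl
    | succ k ih =>
      rw [add_comm, zpow_add, zpow_one]
      exact ih.trans (hstep _)
    | pred k ih =>
      refine ih.trans (Linked.symm ?_)
      have := hstep (((ρ * s) ^ (-(k : ℤ) - 1)) h₀)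
      rwa [← Equiv.Perm.mul_apply, ← zpow_one_add, add_sub_cancel] at this
  -- The orbit is closed under both involutions, so it contains both darts of every linked edge and
  -- misses no boundary end of the component.
  have hdart : ∀ e, N.Linked D (N.boundaryEdge i) e → ∀ c, (ρ * s).SameCycle h₀ (e, c) := by
    have hboth : ∀ e c c', (ρ * s).SameCycle h₀ (e, c) → (ρ * s).SameCycle h₀ (e, c') := by
      intro e c c' hc
      by_cases hcc : c' = c
      · rwa [hcc]
      · rw [Bool.eq_not_of_ne hcc]
        exact (hclosed _ hc).2
    intro e he
    induction he with
    | refl => exact fun c => hboth _ b c (Equiv.Perm.SameCycle.refl _ _)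
    | @tail e e' _ hadj ih =>
      intro c
      obtain ⟨h1, h2, v, h3, h4⟩ := hadj
      by_cases hee : e' = e
      · rw [hee]
        exact ih c
      · obtain ⟨a, ha⟩ := N.incident_iff_dartEnd.1 h3
        have h5 : s (e, a) = (e', a) := nextDart_eq hD h1 ha hee h2 h4
        have h6 := (hclosed _ (ih a)).1
        rw [h5] at h6
        exact hboth _ a c h6
  obtain ⟨i', hi'⟩ := exists_boundary_of_nextDart_eq hD ((hlink _ hcyc).mem hi) hfix
  have hedge : h'.1 = N.boundaryEdge i' := N.eq_boundaryEdge (hi' ▸ N.incident_dartEnd h')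
  refine ⟨i', ?_, ?_, ?_⟩
  · rintro rfl
    refine hne (Prod.ext hedge ?_)
    exact N.side_eq_of_dartEnd_eq (hi'.trans hb.symm)
  · rw [← hedge]
    exact hlink _ hcyc
  · intro i'' hi''
    obtain ⟨c, hc⟩ := N.incident_iff_dartEnd.1 (N.incident_boundaryEdge i'')
    rcases huniq _ (hdart _ hi'' c) (nextDart_of_boundary hc) with h | h
    · left
      exact N.boundaryEdge_injective (congrArg Prod.fst h)
    · right
      exact N.boundaryEdge_injective ((congrArg Prod.fst h).trans hedge)

end Linked

end BipartiteNetwork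

/-! ### Planarity: components as disjoint connected sets -/

namespace BipartiteNetwork

variable {n : ℕ} {V E : Type*} {N : BipartiteNetwork n V E}

section Embedding

theorem DiskEmbedding.norm_pos_le (emb : N.DiskEmbedding) (x : V ⊕ Fin n) : ‖emb.pos x‖ ≤ 1 := by
  rcases x with v | i
  · exact (emb.norm_pos_interior v).le
  · have : -(emb.angle i : ℂ) * Complex.I = ((-emb.angle i : ℝ) : ℂ) * Complex.I := by
      push_cast
      ring
    rw [emb.pos_boundary, this, Complex.norm_exp_ofReal_mul_I]

theorem DiskEmbedding.norm_arc_le (emb : N.DiskEmbedding) (e : E) (t : unitInterval) :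
    ‖emb.arc e t‖ ≤ 1 := by
  by_cases h0 : t = 0
  · rw [h0, Path.source]
    exact emb.norm_pos_le _
  by_cases h1 : t = 1
  · rw [h1, Path.target]
    exact emb.norm_pos_le _
  · exact (emb.norm_arc_lt e t h0 h1).le

/-- The points on the edges that satisfy a predicate. -/
def DiskEmbedding.support (emb : N.DiskEmbedding) (C : E → Prop) : Set ℂ :=
  {z | ∃ e, C e ∧ z ∈ Set.range (emb.arc e)}

theorem DiskEmbedding.norm_le_of_mem_support (emb : N.DiskEmbedding) {C : E → Prop} {z : ℂ}
    (hz : z ∈ emb.support C) : ‖z‖ ≤ 1 := by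
  obtain ⟨e, -, t, rfl⟩ := hz
  exact emb.norm_arc_le e t

theorem DiskEmbedding.joinedIn_of_incident (emb : N.DiskEmbedding) {C : E → Prop} {e : E}
    (he : C e) {x y : V ⊕ Fin n} (hx : N.Incident e x) (hy : N.Incident e y) :
    JoinedIn (emb.support C) (emb.pos x) (emb.pos y) := by
  have h : JoinedIn (emb.support C) (emb.pos (N.blackEnd e)) (emb.pos (N.whiteEnd e)) :=
    ⟨emb.arc e, fun t => ⟨e, he, t, rfl⟩⟩
  rcases hx with rfl | rfl <;> rcases hy with rfl | rfl
  · exact JoinedIn.refl h.source_mem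
  · exact h
  · exact h.symm
  · exact JoinedIn.refl h.target_mem

theorem DiskEmbedding.joinedIn_of_linked (emb : N.DiskEmbedding) {D : Finset E} {e e' : E}
    (h : N.Linked D e e') {x y : V ⊕ Fin n} (hx : N.Incident e x) (hy : N.Incident e' y) :
    JoinedIn (emb.support (N.Linked D e)) (emb.pos x) (emb.pos y) := by
  induction h generalizing y with
  | refl => exact emb.joinedIn_of_incident Relation.ReflTransGen.refl hx hy
  | tail h hadj ih =>
    obtain ⟨v, h1, h2⟩ := hadj.2.2
    exact (ih h1).trans (emb.joinedIn_of_incident (Relation.ReflTransGen.tail h hadj) h2 hy)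

/-- Distinct edges meet only at a common end. A common interior vertex would link the components,
and a boundary vertex has only one edge. -/
theorem DiskEmbedding.disjoint_support (emb : N.DiskEmbedding) {D : Finset E} {e e' : E}
    (he : e ∈ D) (he' : e' ∈ D) (h : ¬ N.Linked D e e') :
    Disjoint (emb.support (N.Linked D e)) (emb.support (N.Linked D e')) := by
  rw [Set.disjoint_left]
  rintro z ⟨f, hf, s, rfl⟩ ⟨f', hf', t, hst⟩
  have hnot : ∀ g, N.Linked D e g → ¬ N.Linked D e' g := fun g h1 h2 => h (h1.trans h2.symm)
  have hne : f ≠ f' := fun h => hnot f hf (h ▸ hf')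
  obtain ⟨hs, ht⟩ := emb.arc_eq_arc f f' s t hne hst.symm
  have hend : ∀ (g : E) (u : unitInterval), u = 0 ∨ u = 1 →
      ∃ x, N.Incident g x ∧ emb.arc g u = emb.pos x := by
    rintro g u (rfl | rfl)
    · exact ⟨_, Or.inl rfl, (emb.arc g).source⟩
    · exact ⟨_, Or.inr rfl, (emb.arc g).target⟩
  obtain ⟨x, hx, hx'⟩ := hend f s hs
  obtain ⟨y, hy, hy'⟩ := hend f' t ht
  have hxy : y = x := emb.pos_injective (by rw [← hx', ← hy', hst])
  subst hxy
  rcases y with v | i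
  · exact hnot f' (hf.trans (Adjacent.linked ⟨hf.mem he, hf'.mem he', v, hx, hy⟩)) hf'
  · exact hne ((N.eq_boundaryEdge hx).trans (N.eq_boundaryEdge hy).symm)

/-- Disjoint paths in a planar network have non-crossing end points. -/
theorem DiskEmbedding.linked_of_interlace (emb : N.DiskEmbedding) {D : Finset E} {a b c d : Fin n}
    (hab : a < b) (hbc : b < c) (hcd : c < d) (ha : N.boundaryEdge a ∈ D)
    (hb : N.boundaryEdge b ∈ D) (hac : N.Linked D (N.boundaryEdge a) (N.boundaryEdge c))
    (hbd : N.Linked D (N.boundaryEdge b) (N.boundaryEdge d)) :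
    N.Linked D (N.boundaryEdge a) (N.boundaryEdge b) := by
  by_contra h
  have h1 := emb.joinedIn_of_linked hac (N.incident_boundaryEdge a) (N.incident_boundaryEdge c)
  have h2 := emb.joinedIn_of_linked hbd (N.incident_boundaryEdge b) (N.incident_boundaryEdge d)
  simp only [emb.pos_boundary] at h1 h2
  exact not_disjoint_of_interlace (emb.angle_strictMono hab) (emb.angle_strictMono hbc)
    (emb.angle_strictMono hcd) (emb.angle_lt a d) (fun z => emb.norm_le_of_mem_support)
    (fun z => emb.norm_le_of_mem_support) h1 h2 (emb.disjoint_support ha hb h)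

end Embedding

/-! ### Symmetric differences and boundary subsets of matchings -/

section Matchings

open scoped Classical
open Finset

variable {P Q : Finset E}

/-- At an interior vertex, the second edge beside one that lies only in `P` is the edge of `Q`
there, and conversely. -/
theorem IsAlmostPerfectMatching.isPathSystem_symmDiff (hP : N.IsAlmostPerfectMatching P)
    (hQ : N.IsAlmostPerfectMatching Q) : N.IsPathSystem (symmDiff P Q) := by
  have key : ∀ {P Q : Finset E}, N.IsAlmostPerfectMatching P → N.IsAlmostPerfectMatching Q →
      ∀ e ∈ P, e ∉ Q → ∀ v, N.Incident e (Sum.inl v) →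
      ∃! e', e' ≠ e ∧ e' ∈ symmDiff P Q ∧ N.Incident e' (Sum.inl v) := by
    intro P Q hP hQ e heP heQ v hv
    obtain ⟨f, ⟨hfQ, hfv⟩, hf⟩ := hQ v
    refine ⟨f, ⟨?_, ?_, hfv⟩, ?_⟩
    · rintro rfl
      exact heQ hfQ
    · refine mem_symmDiff.2 (Or.inr ⟨hfQ, fun hfP => heQ ?_⟩)
      rwa [(hP v).unique ⟨heP, hv⟩ ⟨hfP, hfv⟩]
    · rintro g ⟨hge, hg, hgv⟩
      rcases mem_symmDiff.1 hg with ⟨h, -⟩ | ⟨h, -⟩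
      · exact absurd ((hP v).unique ⟨h, hgv⟩ ⟨heP, hv⟩) hge
      · exact hf g ⟨h, hgv⟩
  intro e he v hv
  rcases mem_symmDiff.1 he with ⟨h1, h2⟩ | ⟨h1, h2⟩
  · exact key hP hQ e h1 h2 v hv
  · rw [symmDiff_comm]
    exact key hQ hP e h1 h2 v hv

/-- Exchanging a union of components of the symmetric difference of two almost perfect matchings
gives an almost perfect matching. -/
theorem IsAlmostPerfectMatching.symmDiff_component (hP : N.IsAlmostPerfectMatching P)
    (hQ : N.IsAlmostPerfectMatching Q) {C : Finset E} (hC : C ⊆ symmDiff P Q)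
    (hclosed : ∀ e ∈ C, ∀ f, N.Adjacent (symmDiff P Q) e f → f ∈ C) :
    N.IsAlmostPerfectMatching (symmDiff P C) := by
  intro v
  obtain ⟨e, ⟨heP, hev⟩, he⟩ := hP v
  obtain ⟨f, ⟨hfQ, hfv⟩, hf⟩ := hQ v
  have hCQ : ∀ x ∈ C, x ∉ P → x ∈ Q := fun x hx hxP => by
    rcases mem_symmDiff.1 (hC hx) with h | h
    · exact absurd h.1 hxP
    · exact h.1
  -- At each interior vertex `C` contains either both edges of the symmetric difference or neither,
  -- so the swap replaces `e` by `f` or leaves `e`.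
  by_cases heC : e ∈ C
  · have heD := hC heC
    have heQ : e ∉ Q := by
      rcases mem_symmDiff.1 heD with h | h
      · exact h.2
      · exact absurd heP h.2
    have hfP : f ∉ P := fun h => heQ (he f ⟨h, hfv⟩ ▸ hfQ)
    have hfC : f ∈ C :=
      hclosed e heC f ⟨heD, mem_symmDiff.2 (Or.inr ⟨hfQ, hfP⟩), v, hev, hfv⟩
    refine ⟨f, ⟨mem_symmDiff.2 (Or.inr ⟨hfC, hfP⟩), hfv⟩, ?_⟩
    rintro x ⟨hx, hxv⟩
    rcases mem_symmDiff.1 hx with ⟨h1, h2⟩ | ⟨h1, h2⟩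
    · exact absurd (he x ⟨h1, hxv⟩ ▸ heC) h2
    · exact hf x ⟨hCQ x h1 h2, hxv⟩
  · refine ⟨e, ⟨mem_symmDiff.2 (Or.inl ⟨heP, heC⟩), hev⟩, ?_⟩
    rintro x ⟨hx, hxv⟩
    rcases mem_symmDiff.1 hx with ⟨h1, h2⟩ | ⟨h1, h2⟩
    · exact he x ⟨h1, hxv⟩
    · exfalso
      have hxf := hf x ⟨hCQ x h1 h2, hxv⟩
      subst hxf
      have heQ : e ∉ Q := fun h => h2 (hf e ⟨h, hev⟩ ▸ heP)
      exact heC (hclosed x h1 e ⟨hC h1, mem_symmDiff.2 (Or.inl ⟨heP, heQ⟩), v, hfv, hev⟩)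

theorem exists_incident_boundary_iff {i : Fin n} :
    (∃ e ∈ P, N.Incident e (Sum.inr i)) ↔ N.boundaryEdge i ∈ P :=
  ⟨fun ⟨_, he, hi⟩ => N.eq_boundaryEdge hi ▸ he, fun h => ⟨_, h, N.incident_boundaryEdge i⟩⟩

theorem mem_boundarySubset {i : Fin n} : i ∈ N.boundarySubset P ↔
    (N.color (Sum.inr i) = VertexColor.black ∧ N.boundaryEdge i ∈ P) ∨
    (N.color (Sum.inr i) = VertexColor.white ∧ N.boundaryEdge i ∉ P) := by
  rw [boundarySubset, mem_filter, exists_incident_boundary_iff]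
  simp

/-- Toggling the edge at a boundary vertex toggles membership for either colour; the opposite
conventions for black and white do not matter here. -/
theorem mem_boundarySubset_symmDiff {C : Finset E} {i : Fin n} :
    i ∈ N.boundarySubset (symmDiff P C) ↔
      Xor (i ∈ N.boundarySubset P) (N.boundaryEdge i ∈ C) := by
  simp only [mem_boundarySubset, mem_symmDiff, Xor]
  cases N.color (Sum.inr i) <;> simp
  all_goals tauto

theorem boundaryEdge_mem_symmDiff {i : Fin n} : N.boundaryEdge i ∈ symmDiff P Q ↔
    i ∈ symmDiff (N.boundarySubset P) (N.boundarySubset Q) := by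
  simp only [mem_boundarySubset, mem_symmDiff]
  cases N.color (Sum.inr i) <;> simp
  all_goals tauto

theorem card_filter_sum {α β : Type*} [Fintype α] [Fintype β] (p : α ⊕ β → Prop)
    [DecidablePred p] [DecidablePred fun a => p (Sum.inl a)] [DecidablePred fun b => p (Sum.inr b)] :
    #{x | p x} = #{a | p (Sum.inl a)} + #{b | p (Sum.inr b)} := by
  simp only [card_filter, Fintype.sum_sum_type]
  congr!

/-- Each edge is counted at its end of the given colour. Comparing the counts for the two colours
determines the size of the boundary subset. -/
theorem IsAlmostPerfectMatching.card_eq [Fintype V] (hP : N.IsAlmostPerfectMatching P)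
    (b : Bool) (col : VertexColor) (hcol : col = cond b VertexColor.black VertexColor.white) :
    #P = #{v : V | N.color (Sum.inl v) = col} +
      #{i : Fin n | N.color (Sum.inr i) = col ∧ N.boundaryEdge i ∈ P} := by
  have h1 : #P = #{x : V ⊕ Fin n | N.color x = col ∧ ∃ e ∈ P, N.Incident e x} := by
    refine card_bij (fun e _ => N.dartEnd (e, b)) ?_ ?_ ?_
    · intro e he
      rw [mem_filter_univ, color_dartEnd, hcol]
      exact ⟨rfl, e, he, N.incident_dartEnd (e, b)⟩
    · intro e he e' he' h
      have hi := N.incident_dartEnd (e, b)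
      have hi' := N.incident_dartEnd (e', b)
      rw [← h] at hi'
      rcases hx : N.dartEnd (e, b) with v | i
      · rw [hx] at hi hi'
        exact (hP v).unique ⟨he, hi⟩ ⟨he', hi'⟩
      · rw [hx] at hi hi'
        exact (N.eq_boundaryEdge hi).trans (N.eq_boundaryEdge hi').symm
    · intro x hx
      rw [mem_filter_univ] at hx
      obtain ⟨hx, e, he, hex⟩ := hx
      refine ⟨e, he, ?_⟩
      obtain ⟨b', hb'⟩ := N.incident_iff_dartEnd.1 hex
      have h2 := N.color_dartEnd (e, b')
      rw [hb', hx, hcol] at h2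
      have : b = b' := by
        revert h2
        cases b <;> cases b' <;> simp
      rw [this, hb']
  rw [h1, card_filter_sum]
  congr 1
  · congr 1
    ext v
    rw [mem_filter_univ, mem_filter_univ]
    exact and_iff_left (hP v).exists
  · congr 1
    ext i
    rw [mem_filter_univ, mem_filter_univ, exists_incident_boundary_iff]

theorem adjacent_black_iff {i : Fin n} :
    (∃ (e : E) (v : V), N.Incident e (Sum.inr i) ∧ N.Incident e (Sum.inl v) ∧
      N.color (Sum.inl v) = VertexColor.black) ↔
    N.color (Sum.inr i) = VertexColor.white := by
  constructor
  · rintro ⟨e, v, h1, h2, h3⟩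
    rcases h1 with h1 | h1
    · rcases h2 with h2 | h2
      · rw [h1] at h2
        cases h2
      · rw [← h2, N.color_whiteEnd] at h3
        cases h3
    · rw [← h1, N.color_whiteEnd]
  · intro h
    have h1 := N.incident_boundaryEdge i
    rcases h1 with h1 | h1
    · rw [← h1, N.color_blackEnd] at h
      cases h
    · rcases h2 : N.blackEnd (N.boundaryEdge i) with v | j
      · refine ⟨_, v, Or.inr h1, Or.inl h2, ?_⟩
        rw [← h2, N.color_blackEnd]
      · exact absurd ⟨h2, h1⟩ (N.not_boundary_boundary _ j i)

theorem IsAlmostPerfectMatching.card_boundarySubset [Fintype V]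
    (hP : N.IsAlmostPerfectMatching P) : (#(N.boundarySubset P) : ℤ) = N.rank := by
  have hb := hP.card_eq true _ rfl
  have hw := hP.card_eq false _ rfl
  have h1 : #(N.boundarySubset P) =
      #{i : Fin n | N.color (Sum.inr i) = VertexColor.black ∧ N.boundaryEdge i ∈ P} +
      #{i : Fin n | N.color (Sum.inr i) = VertexColor.white ∧ N.boundaryEdge i ∉ P} := by
    rw [← card_union_of_disjoint]
    · congr 1
      ext i
      simp [mem_boundarySubset]
    · rw [disjoint_filter]
      rintro i - ⟨h, -⟩ ⟨h', -⟩
      rw [h] at h'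
      cases h'
  have h2 : #{i : Fin n | N.color (Sum.inr i) = VertexColor.white} =
      #{i : Fin n | N.color (Sum.inr i) = VertexColor.white ∧ N.boundaryEdge i ∈ P} +
      #{i : Fin n | N.color (Sum.inr i) = VertexColor.white ∧ N.boundaryEdge i ∉ P} := by
    rw [← card_filter_add_card_filter_not (p := fun i => N.boundaryEdge i ∈ P), filter_filter,
      filter_filter]
  rw [rank]
  simp only [adjacent_black_iff, cond_true, cond_false] at hb hw ⊢
  omega

end Matchings

end BipartiteNetwork

/-! ### Ends of paths and their non-crossing -/

namespace BipartiteNetwork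

variable {n : ℕ} {V E : Type*} {N : BipartiteNetwork n V E}

open scoped Classical
open Finset

section PathEnds

variable (N) in
/-- The other boundary vertex of the path of `D` that starts at the boundary vertex `i`. -/
noncomputable def pathEnd (D : Finset E) (i : Fin n) : Fin n :=
  if h : ∃ i', i' ≠ i ∧ N.Linked D (N.boundaryEdge i) (N.boundaryEdge i') ∧
      ∀ i'', N.Linked D (N.boundaryEdge i) (N.boundaryEdge i'') → i'' = i ∨ i'' = i'
  -- The default `i` is never reached in a path system with the edge at `i` in `D`, by
  -- `exists_path_end`.
  then h.choose else i

variable (N) in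
/-- The edges of the path of `D` that starts at the boundary vertex `i`. -/
noncomputable def pathEdges (D : Finset E) (i : Fin n) : Finset E :=
  {e ∈ D | N.Linked D (N.boundaryEdge i) e}

variable {D : Finset E} {i : Fin n}

theorem pathEdges_subset : N.pathEdges D i ⊆ D :=
  filter_subset _ _

theorem pathEnd_spec [Finite E] (hD : N.IsPathSystem D) (hi : N.boundaryEdge i ∈ D) :
    N.pathEnd D i ≠ i ∧ N.Linked D (N.boundaryEdge i) (N.boundaryEdge (N.pathEnd D i)) ∧
      ∀ i'', N.Linked D (N.boundaryEdge i) (N.boundaryEdge i'') →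
        i'' = i ∨ i'' = N.pathEnd D i := by
  rw [pathEnd, dif_pos (exists_path_end hD hi)]
  exact (exists_path_end hD hi).choose_spec

theorem pathEnd_pathEnd [Finite E] (hD : N.IsPathSystem D) (hi : N.boundaryEdge i ∈ D) :
    N.pathEnd D (N.pathEnd D i) = i := by
  obtain ⟨h1, h2, h3⟩ := pathEnd_spec hD hi
  obtain ⟨h4, h5, -⟩ := pathEnd_spec hD (h2.mem hi)
  exact (h3 _ (h2.trans h5)).resolve_right h4

theorem pathEdges_pathEnd [Finite E] (hD : N.IsPathSystem D) (hi : N.boundaryEdge i ∈ D) :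
    N.pathEdges D (N.pathEnd D i) = N.pathEdges D i := by
  have h := (pathEnd_spec hD hi).2.1
  ext e
  rw [pathEdges, pathEdges, mem_filter, mem_filter]
  exact and_congr_right fun _ => ⟨fun h' => h.trans h', fun h' => h.symm.trans h'⟩

theorem boundaryEdge_mem_pathEdges [Finite E] (hD : N.IsPathSystem D)
    (hi : N.boundaryEdge i ∈ D) {j : Fin n} :
    N.boundaryEdge j ∈ N.pathEdges D i ↔ j = i ∨ j = N.pathEnd D i := by
  obtain ⟨h1, h2, h3⟩ := pathEnd_spec hD hi
  rw [pathEdges, mem_filter]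
  constructor
  · exact fun h => h3 j h.2
  · rintro (rfl | rfl)
    · exact ⟨hi, Relation.ReflTransGen.refl⟩
    · exact ⟨h2.mem hi, h2⟩

theorem pathEdges_closed {e f : E} (he : e ∈ N.pathEdges D i) (h : N.Adjacent D e f) :
    f ∈ N.pathEdges D i := by
  rw [pathEdges, mem_filter] at he ⊢
  exact ⟨h.2.1, he.2.trans h.linked⟩

/-- If `d` were outside the interval, the two pairs of ends would interlace or share a vertex, and
the components would be linked. -/
theorem DiskEmbedding.between_of_linked (emb : N.DiskEmbedding) {x y c d : Fin n}
    (hx : N.boundaryEdge x ∈ D) (hc : N.boundaryEdge c ∈ D) (hxc : x < c) (hcy : c < y)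
    (hxy : N.Linked D (N.boundaryEdge x) (N.boundaryEdge y))
    (hcd : N.Linked D (N.boundaryEdge c) (N.boundaryEdge d))
    (hnot : ¬ N.Linked D (N.boundaryEdge x) (N.boundaryEdge c)) : x < d ∧ d < y := by
  constructor
  · by_contra! h
    rcases h.lt_or_eq with h | rfl
    · exact hnot ((emb.linked_of_interlace h hxc hcy (hcd.mem hc) hx hcd.symm hxy).symm.trans
        hcd.symm)
    · exact hnot hcd.symm
  · by_contra! h
    rcases h.lt_or_eq with h | rfl
    · exact hnot (emb.linked_of_interlace hxc hcy h hx hc hxy hcd)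
    · exact hnot (hxy.trans hcd.symm)

theorem DiskEmbedding.pathEnd_between [Finite E] (emb : N.DiskEmbedding)
    (hD : N.IsPathSystem D) (hi : N.boundaryEdge i ∈ D) {z : Fin n} (hz : N.boundaryEdge z ∈ D)
    (h : min i (N.pathEnd D i) < z ∧ z < max i (N.pathEnd D i)) :
    min i (N.pathEnd D i) < N.pathEnd D z ∧ N.pathEnd D z < max i (N.pathEnd D i) := by
  obtain ⟨h1, h2, h3⟩ := pathEnd_spec hD hi
  have hz' := (pathEnd_spec hD hz).2.1
  rcases lt_or_gt_of_ne h1 with hlt | hlt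
  · rw [min_eq_right hlt.le, max_eq_left hlt.le] at h ⊢
    refine emb.between_of_linked (h2.mem hi) hz h.1 h.2 h2.symm hz' fun h' => ?_
    rcases h3 z (h2.trans h') with rfl | h4
    · exact h.2.ne rfl
    · exact h.1.ne h4.symm
  · rw [min_eq_left hlt.le, max_eq_right hlt.le] at h ⊢
    refine emb.between_of_linked hi hz h.1 h.2 h2 hz' fun h' => ?_
    rcases h3 z h' with rfl | h4
    · exact h.1.ne rfl
    · exact h.2.ne h4

end PathEnds

/-! ### Swapping two matchings along a path -/

section Exchange

variable {P Q : Finset E} {i : Fin n}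

/-- The matching obtained from `P` by exchanging `P` and `Q` along the path that starts at `i`. -/
theorem IsAlmostPerfectMatching.exchange (hP : N.IsAlmostPerfectMatching P)
    (hQ : N.IsAlmostPerfectMatching Q) :
    N.IsAlmostPerfectMatching (symmDiff P (N.pathEdges (symmDiff P Q) i)) :=
  hP.symmDiff_component hQ pathEdges_subset fun _ he _ hf => pathEdges_closed he hf

theorem IsAlmostPerfectMatching.mem_boundarySubset_exchange [Finite E]
    (hP : N.IsAlmostPerfectMatching P) (hQ : N.IsAlmostPerfectMatching Q)
    (hi : N.boundaryEdge i ∈ symmDiff P Q) {R : Finset E} {j : Fin n} :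
    j ∈ N.boundarySubset (symmDiff R (N.pathEdges (symmDiff P Q) i)) ↔
      Xor (j ∈ N.boundarySubset R) (j = i ∨ j = N.pathEnd (symmDiff P Q) i) := by
  rw [mem_boundarySubset_symmDiff,
    boundaryEdge_mem_pathEdges (hP.isPathSystem_symmDiff hQ) hi]

theorem IsAlmostPerfectMatching.card_boundarySubset_eq [Fintype V]
    (hP : N.IsAlmostPerfectMatching P) (hQ : N.IsAlmostPerfectMatching Q) :
    #(N.boundarySubset P) = #(N.boundarySubset Q) := by
  have := hP.card_boundarySubset
  have := hQ.card_boundarySubset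
  omega

/-- Exactly one of the two ends of a path belongs to the boundary subset. -/
theorem IsAlmostPerfectMatching.pathEnd_mem_iff [Fintype V] [Finite E]
    (hP : N.IsAlmostPerfectMatching P) (hQ : N.IsAlmostPerfectMatching Q)
    (hi : N.boundaryEdge i ∈ symmDiff P Q) :
    N.pathEnd (symmDiff P Q) i ∈ N.boundarySubset P ↔ i ∉ N.boundarySubset P := by
  -- The swap toggles exactly the two ends of the path and keeps the size of the boundary subset, so
  -- one end enters and the other leaves. No parity argument along the path is needed.
  have hcard := hP.card_boundarySubset_eq (hP.exchange (i := i) hQ)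
  have hmem := fun j => hP.mem_boundarySubset_exchange hQ hi (R := P) (j := j)
  simp only [Xor] at hmem
  constructor
  · intro h1 h2
    refine (card_lt_card ((ssubset_iff_of_subset ?_).2 ⟨i, h2, ?_⟩)).ne' hcard
    · intro j hj
      rcases (hmem j).1 hj with h | ⟨rfl | rfl, h⟩
      · exact h.1
      · exact h2
      · exact h1
    · rw [hmem]
      tauto
  · intro h2
    by_contra h1
    refine (card_lt_card ((ssubset_iff_of_subset ?_).2 ⟨i, ?_, h2⟩)).ne hcard
    · intro j hj
      rw [hmem]
      refine Or.inl ⟨hj, ?_⟩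
      rintro (rfl | rfl)
      · exact h2 hj
      · exact h1 hj
    · rw [hmem]
      tauto

/-- By planarity, the two boundary subsets have equally many elements strictly between the two ends
of a path. -/
theorem DiskEmbedding.card_between_eq [Fintype V] [Finite E] (emb : N.DiskEmbedding)
    (hP : N.IsAlmostPerfectMatching P) (hQ : N.IsAlmostPerfectMatching Q)
    (hi : N.boundaryEdge i ∈ symmDiff P Q) {b : Fin n} (hb : b = N.pathEnd (symmDiff P Q) i) :
    #{z ∈ N.boundarySubset P | min i b < z ∧ z < max i b} =
      #{z ∈ N.boundarySubset Q | min i b < z ∧ z < max i b} := by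
  subst hb
  set D := symmDiff P Q with hDdef
  have hD : N.IsPathSystem D := hP.isPathSystem_symmDiff hQ
  set B : Fin n → Prop := fun z => min i (N.pathEnd D i) < z ∧ z < max i (N.pathEnd D i) with hB
  have hPmem : ∀ z, N.boundaryEdge z ∈ D →
      (N.pathEnd D z ∈ N.boundarySubset P ↔ z ∉ N.boundarySubset P) :=
    fun z hz => hP.pathEnd_mem_iff hQ hz
  have hQmem : ∀ z, N.boundaryEdge z ∈ D →
      (N.pathEnd D z ∈ N.boundarySubset Q ↔ z ∉ N.boundarySubset Q) := by
    intro z hz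
    rw [hDdef, symmDiff_comm] at hz ⊢
    exact hQ.pathEnd_mem_iff hP hz
  have hDmem : ∀ z, N.boundaryEdge z ∈ D ↔ z ∈ symmDiff (N.boundarySubset P) (N.boundarySubset Q) :=
    fun z => boundaryEdge_mem_symmDiff
  -- `pathEnd` is a bijection between the two differences, and non-crossing keeps it inside the
  -- interval. The intersection contributes equally to both counts.
  have key : #((N.boundarySubset P \ N.boundarySubset Q).filter B) =
      #((N.boundarySubset Q \ N.boundarySubset P).filter B) := by
    refine card_nbij' (N.pathEnd D) (N.pathEnd D) ?_ ?_ ?_ ?_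
    · intro z hz
      simp only [coe_filter, Set.mem_ofPred_eq, mem_sdiff] at hz ⊢
      have hzD : N.boundaryEdge z ∈ D := (hDmem z).2 (mem_symmDiff.2 (Or.inl hz.1))
      have h1 := hPmem z hzD
      have h2 := hQmem z hzD
      exact ⟨by tauto, emb.pathEnd_between hD hi hzD hz.2⟩
    · intro z hz
      simp only [coe_filter, Set.mem_ofPred_eq, mem_sdiff] at hz ⊢
      have hzD : N.boundaryEdge z ∈ D := (hDmem z).2 (mem_symmDiff.2 (Or.inr hz.1))
      have h1 := hPmem z hzD
      have h2 := hQmem z hzD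
      exact ⟨by tauto, emb.pathEnd_between hD hi hzD hz.2⟩
    · intro z hz
      simp only [coe_filter, Set.mem_ofPred_eq, mem_sdiff] at hz
      exact pathEnd_pathEnd hD ((hDmem z).2 (mem_symmDiff.2 (Or.inl hz.1)))
    · intro z hz
      simp only [coe_filter, Set.mem_ofPred_eq, mem_sdiff] at hz
      exact pathEnd_pathEnd hD ((hDmem z).2 (mem_symmDiff.2 (Or.inr hz.1)))
  have hsplit : ∀ S T : Finset (Fin n), #(S.filter B) = #((S \ T).filter B) + #((S ∩ T).filter B) := by
    intro S T
    rw [← card_union_of_disjoint, ← filter_union, sdiff_union_inter]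
    exact disjoint_filter_filter (disjoint_sdiff_inter S T)
  rw [hsplit _ (N.boundarySubset Q), key, inter_comm, ← hsplit]

theorem prod_symmDiff_mul_prod_symmDiff [Fintype E] {M : Type*} [CommMonoid M] (w : E → M)
    {C : Finset E} (hC : C ⊆ symmDiff P Q) :
    (∏ e ∈ symmDiff P C, w e) * ∏ e ∈ symmDiff Q C, w e =
      (∏ e ∈ P, w e) * ∏ e ∈ Q, w e := by
  have h : ∀ S : Finset E, ∏ e ∈ S, w e = ∏ e, if e ∈ S then w e else 1 := fun S => by
    rw [prod_ite_mem, univ_inter]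
  simp only [h]
  rw [← prod_mul_distrib, ← prod_mul_distrib]
  refine prod_congr rfl fun e _ => ?_
  have hCe : e ∈ C → (e ∈ P ∧ e ∉ Q ∨ e ∈ Q ∧ e ∉ P) := fun h => mem_symmDiff.1 (hC h)
  by_cases h1 : e ∈ C <;> by_cases h2 : e ∈ P <;> by_cases h3 : e ∈ Q <;>
    simp_all [mem_symmDiff]

theorem symmDiff_exchange (C : Finset E) :
    symmDiff (symmDiff P C) (symmDiff Q C) = symmDiff P Q := by
  rw [symmDiff_symmDiff_symmDiff_comm, symmDiff_self, symmDiff_bot]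

end Exchange

/-! ### The sign-reversing involution -/

section Plucker

theorem antisymmetricCoord_dimerPartition [Fintype E] {k : ℕ} (f : Fin k → Fin n) :
    antisymmetricCoord N.dimerPartition f =
      ∑ P : Finset E, if N.IsAlmostPerfectMatching P ∧ N.boundarySubset P = univ.image f then
        (orderSign (fun x => (f x : ℤ)) : ℝ) * ∏ e ∈ P, N.weight e else 0 := by
  rw [antisymmetricCoord_eq, dimerPartition, mul_sum, sum_filter]

theorem mem_image_snoc {m : ℕ} {i : Fin m → Fin n} {a z : Fin n} :
    z ∈ univ.image (Fin.snoc i a : Fin (m + 1) → Fin n) ↔ (∃ x, i x = z) ∨ z = a := by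
  simp only [mem_image, mem_univ, true_and, Fin.exists_fin_succ', Fin.snoc_castSucc,
    Fin.snoc_last, eq_comm (a := z)]

theorem mem_image_succAbove {m : ℕ} {j : Fin (m + 1) → Fin n} {s : Fin (m + 1)} {z : Fin n} :
    z ∈ univ.image (fun x => j (s.succAbove x)) ↔ ∃ t, t ≠ s ∧ j t = z := by
  simp only [mem_image, mem_univ, true_and]
  constructor
  · rintro ⟨a, rfl⟩
    exact ⟨_, Fin.succAbove_ne s a, rfl⟩
  · rintro ⟨t, ht, rfl⟩
    obtain ⟨a, ha⟩ := Fin.exists_succAbove_eq ht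
    exact ⟨a, by rw [ha]⟩

/-- Exchanging two matchings along the path that starts at `j s` exchanges `j s` with another
index `j t`. -/
theorem IsAlmostPerfectMatching.exists_exchange_index [Fintype V] [Finite E] {m : ℕ}
    {i : Fin m → Fin n} {j : Fin (m + 2) → Fin n} (hj : Function.Injective j) {s : Fin (m + 2)}
    {P Q : Finset E} (hP : N.IsAlmostPerfectMatching P) (hQ : N.IsAlmostPerfectMatching Q)
    (hPI : N.boundarySubset P = univ.image (Fin.snoc i (j s) : Fin (m + 1) → Fin n))
    (hQI : N.boundarySubset Q = univ.image (fun x => j (s.succAbove x)))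
    (his : ∀ x, i x ≠ j s) :
    ∃ t, t ≠ s ∧ N.boundaryEdge (j s) ∈ symmDiff P Q ∧
      N.pathEnd (symmDiff P Q) (j s) = j t ∧ (∀ x, i x ≠ j t) ∧
      N.boundarySubset (symmDiff P (N.pathEdges (symmDiff P Q) (j s))) =
        univ.image (Fin.snoc i (j t) : Fin (m + 1) → Fin n) ∧
      N.boundarySubset (symmDiff Q (N.pathEdges (symmDiff P Q) (j s))) =
        univ.image (fun x => j (t.succAbove x)) := by
  have haP : j s ∈ N.boundarySubset P := by
    rw [hPI, mem_image_snoc]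
    exact Or.inr rfl
  have haQ : j s ∉ N.boundarySubset Q := by
    rw [hQI, mem_image_succAbove]
    rintro ⟨t, ht, hts⟩
    exact ht (hj hts)
  have haD : N.boundaryEdge (j s) ∈ symmDiff P Q :=
    boundaryEdge_mem_symmDiff.2 (mem_symmDiff.2 (Or.inl ⟨haP, haQ⟩))
  have hbP := (hP.pathEnd_mem_iff hQ haD).not.2 (not_not.2 haP)
  have hbQ : N.pathEnd (symmDiff P Q) (j s) ∈ N.boundarySubset Q := by
    rw [symmDiff_comm] at haD ⊢
    exact (hQ.pathEnd_mem_iff hP haD).2 haQ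
  rw [hQI, mem_image_succAbove] at hbQ
  obtain ⟨t, hts, ht⟩ := hbQ
  have hit : ∀ x, i x ≠ j t := by
    intro x hx
    rw [hPI, mem_image_snoc, ← ht] at hbP
    exact hbP (Or.inl ⟨x, hx⟩)
  refine ⟨t, hts, haD, ht.symm, hit, ?_, ?_⟩
  · ext z
    rw [hP.mem_boundarySubset_exchange hQ haD, ← ht, hPI, mem_image_snoc, mem_image_snoc]
    constructor
    · rintro (⟨h1 | h1, h2⟩ | ⟨h1 | h1, h2⟩)
      · exact Or.inl h1
      · exact absurd (Or.inl h1) h2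
      · exact absurd (Or.inr h1) h2
      · exact Or.inr h1
    · rintro (⟨x, rfl⟩ | rfl)
      · exact Or.inl ⟨Or.inl ⟨x, rfl⟩, fun h => h.elim (his x) (hit x)⟩
      · exact Or.inr ⟨Or.inr rfl, fun h => h.elim (fun ⟨x, hx⟩ => hit x hx) fun h => hts (hj h)⟩
  · ext z
    rw [hP.mem_boundarySubset_exchange hQ haD, ← ht, hQI, mem_image_succAbove,
      mem_image_succAbove]
    constructor
    · rintro (⟨⟨u, hu, rfl⟩, h⟩ | ⟨rfl | rfl, h⟩)
      · exact ⟨u, fun hut => h (Or.inr (by rw [hut])), rfl⟩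
      · exact ⟨s, hts.symm, rfl⟩
      · exact absurd ⟨t, hts, rfl⟩ h
    · rintro ⟨u, hu, rfl⟩
      by_cases hus : u = s
      · subst hus
        exact Or.inr ⟨Or.inl rfl, fun ⟨w, hw, hw'⟩ => hw (hj hw')⟩
      · refine Or.inl ⟨⟨u, hus, rfl⟩, ?_⟩
        rintro (h | h)
        · exact hus (hj h)
        · exact hu (hj h)

theorem pluckerRelations_dimerPartition [Fintype V] [Fintype E] (emb : N.DiskEmbedding) (k : ℕ) :
    PluckerRelations k N.dimerPartition := by
  intro m _ i j
  by_cases hj : Function.Injective j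
  swap
  · exact pluckerSum_eq_zero_of_not_injective _ i hj
  set IP : Fin (m + 2) → Finset (Fin n) := fun s =>
    univ.image (Fin.snoc i (j s) : Fin (m + 1) → Fin n) with hIP
  set IQ : Fin (m + 2) → Finset (Fin n) := fun s => univ.image fun x => j (s.succAbove x) with hIQ
  set σ : Fin (m + 2) → ℤ := fun s => (-1) ^ (s : ℕ) *
    orderSign (fun x => ((Fin.snoc i (j s) : Fin (m + 1) → Fin n) x : ℤ)) *
    orderSign (fun x => (j (s.succAbove x) : ℤ)) with hσ
  set T : Finset (Fin (m + 2) × Finset E × Finset E) :=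
    {x | (N.IsAlmostPerfectMatching x.2.1 ∧ N.boundarySubset x.2.1 = IP x.1) ∧
      N.IsAlmostPerfectMatching x.2.2 ∧ N.boundarySubset x.2.2 = IQ x.1} with hT
  set F : Fin (m + 2) × Finset E × Finset E → ℝ := fun x =>
    (σ x.1 : ℝ) * ((∏ e ∈ x.2.1, N.weight e) * ∏ e ∈ x.2.2, N.weight e) with hF
  have hsum : ∑ s : Fin (m + 2), (-1 : ℝ) ^ (s : ℕ) *
      antisymmetricCoord N.dimerPartition (Fin.snoc (α := fun _ => Fin n) i (j s)) *
      antisymmetricCoord N.dimerPartition (fun t : Fin (m + 1) => j (s.succAbove t)) =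
        ∑ x ∈ T, F x := by
    rw [hT, sum_filter, Fintype.sum_prod_type]
    refine sum_congr rfl fun s _ => ?_
    rw [Fintype.sum_prod_type, antisymmetricCoord_dimerPartition, antisymmetricCoord_dimerPartition,
      mul_assoc, sum_mul_sum, mul_sum]
    refine sum_congr rfl fun P _ => ?_
    rw [mul_sum]
    refine sum_congr rfl fun Q _ => ?_
    rw [ite_zero_mul_ite_zero, mul_ite, mul_zero]
    refine if_congr Iff.rfl ?_ rfl
    simp only [hF, hσ]
    push_cast
    ring
  rw [hsum]
  by_cases hi : Function.Injective i
  swap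
  · refine sum_eq_zero fun x _ => ?_
    have : σ x.1 = 0 := by
      rw [hσ]
      simp only
      rw [orderSign_eq_zero, mul_zero, zero_mul]
      intro h
      refine hi fun a b hab => ?_
      have := @h a.castSucc b.castSucc (by simp [hab])
      exact Fin.castSucc_injective _ this
    simp only [hF, this, Int.cast_zero, zero_mul]
  -- Terms with `j s` among the `i` have sign zero. They must be discarded because the swap needs `j
  -- s` to leave the first index set.
  rw [← sum_filter_of_ne (p := fun x => ∀ a, i a ≠ j x.1)]
  swap
  · intro x _ hx a ha
    refine hx ?_
    have : σ x.1 = 0 := by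
      rw [hσ]
      simp only
      rw [orderSign_eq_zero, mul_zero, zero_mul]
      intro h
      have := @h a.castSucc (Fin.last m) (by simp [ha])
      exact (Fin.castSucc_lt_last a).ne this
    simp only [hF, this, Int.cast_zero, zero_mul]
  set T' := T.filter (fun x => ∀ a, i a ≠ j x.1) with hT'
  have hmemT' : ∀ s P Q, (s, P, Q) ∈ T' ↔
      ((N.IsAlmostPerfectMatching P ∧ N.boundarySubset P = IP s) ∧
        N.IsAlmostPerfectMatching Q ∧ N.boundarySubset Q = IQ s) ∧ ∀ a, i a ≠ j s := by
    intro s P Q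
    rw [hT', hT, mem_filter, mem_filter_univ]
  have core : ∀ s P Q, (s, P, Q) ∈ T' → ∃ t, t ≠ s ∧ N.boundaryEdge (j s) ∈ symmDiff P Q ∧
      N.pathEnd (symmDiff P Q) (j s) = j t ∧
      (t, symmDiff P (N.pathEdges (symmDiff P Q) (j s)),
        symmDiff Q (N.pathEdges (symmDiff P Q) (j s))) ∈ T' ∧
      F (s, P, Q) + F (t, symmDiff P (N.pathEdges (symmDiff P Q) (j s)),
        symmDiff Q (N.pathEdges (symmDiff P Q) (j s))) = 0 := by
    intro s P Q hx
    obtain ⟨⟨⟨hP, hPI⟩, hQ, hQI⟩, his⟩ := (hmemT' s P Q).1 hx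
    obtain ⟨t, hts, haD, ht, hit, hPI', hQI'⟩ := hP.exists_exchange_index hj hQ hPI hQI his
    have hQ' := hQ.exchange hP (i := j s)
    rw [symmDiff_comm Q P] at hQ'
    refine ⟨t, hts, haD, ht, (hmemT' _ _ _).2 ⟨⟨⟨hP.exchange hQ, hPI'⟩, hQ', hQI'⟩, hit⟩, ?_⟩
    have hcard := emb.card_between_eq hP hQ haD ht.symm
    rw [hPI, hQI] at hcard
    have hsign : σ s = -σ t := orderSign_exchange hi hj hts.symm his hit hcard
    simp only [hF]
    rw [prod_symmDiff_mul_prod_symmDiff N.weight pathEdges_subset, hsign]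
    push_cast
    ring
  -- `Function.invFun j` recovers `t` from the path end `j t`. Swapping preserves the symmetric
  -- difference, and the path from `j t` is the path from `j s`, so the map is its own inverse.
  refine sum_involution (fun x _ =>
    (Function.invFun j (N.pathEnd (symmDiff x.2.1 x.2.2) (j x.1)),
      symmDiff x.2.1 (N.pathEdges (symmDiff x.2.1 x.2.2) (j x.1)),
      symmDiff x.2.2 (N.pathEdges (symmDiff x.2.1 x.2.2) (j x.1)))) ?_ ?_ ?_ ?_
  · rintro ⟨s, P, Q⟩ hx
    obtain ⟨t, hts, haD, ht, hmem, hzero⟩ := core s P Q hx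
    simp only [ht, Function.leftInverse_invFun hj t]
    exact hzero
  · rintro ⟨s, P, Q⟩ hx _
    obtain ⟨t, hts, haD, ht, hmem, hzero⟩ := core s P Q hx
    simp only [ht, Function.leftInverse_invFun hj t]
    exact fun h => hts (congrArg Prod.fst h)
  · rintro ⟨s, P, Q⟩ hx
    obtain ⟨t, hts, haD, ht, hmem, hzero⟩ := core s P Q hx
    simp only [ht, Function.leftInverse_invFun hj t]
    exact hmem
  · rintro ⟨s, P, Q⟩ hx
    obtain ⟨t, hts, haD, ht, hmem, hzero⟩ := core s P Q hx
    obtain ⟨⟨⟨hP, -⟩, hQ, -⟩, -⟩ := (hmemT' s P Q).1 hx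
    have hD := hP.isPathSystem_symmDiff hQ
    have h1 := pathEnd_pathEnd hD haD
    have h2 := pathEdges_pathEnd hD haD
    rw [ht] at h1 h2
    simp only [ht, Function.leftInverse_invFun hj _, symmDiff_exchange, h1, h2,
      symmDiff_symmDiff_cancel_right]

theorem dimerPartition_pos [Fintype E] (hweight : ∀ e, 0 ≤ N.weight e) {P : Finset E}
    (hP : N.IsAlmostPerfectMatching P) (hne : ∀ e ∈ P, N.weight e ≠ 0) :
    0 < N.dimerPartition (N.boundarySubset P) := by
  rw [dimerPartition]
  refine sum_pos' (fun Q _ => prod_nonneg fun e _ => hweight e) ⟨P, ?_, ?_⟩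
  · rw [mem_filter_univ]
    exact ⟨hP, rfl⟩
  · exact prod_pos fun e he => (hweight e).lt_of_ne (hne e he).symm

end Plucker

end BipartiteNetwork

/-! ### The main theorem -/

theorem mainTheorem2 {n : ℕ} {V E : Type*} [Fintype V] [Fintype E]
    (N : BipartiteNetwork n V E) (emb : N.DiskEmbedding)
    (hweight : ∀ e : E, 0 ≤ N.weight e)
    (hmatching : ∃ P : Finset E, N.IsAlmostPerfectMatching P) :
    ∃ k : ℕ, (k : ℤ) = N.rank ∧
      (∀ P : Finset E, N.IsAlmostPerfectMatching P → (N.boundarySubset P).card = k) ∧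
      PluckerRelations k N.dimerPartition ∧
      ((∃ P : Finset E, N.IsAlmostPerfectMatching P ∧ ∀ e ∈ P, N.weight e ≠ 0) →
        ∃! X : ComplexGrassmannian k n, IsPluckerCoordinates X N.dimerPartition) := by
  obtain ⟨P₀, hP₀⟩ := hmatching
  refine ⟨(N.boundarySubset P₀).card, hP₀.card_boundarySubset,
    fun P hP => hP.card_boundarySubset_eq hP₀,
    BipartiteNetwork.pluckerRelations_dimerPartition emb _, ?_⟩
  rintro ⟨P, hP, hne⟩
  exact (BipartiteNetwork.pluckerRelations_dimerPartition emb _).existsUnique_subspace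
    (hP.card_boundarySubset_eq hP₀) (BipartiteNetwork.dimerPartition_pos hweight hP hne).ne'
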